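/- Let $N\ge 0$ and $\beta\ge 0$ be integers, let $\gamma>-\tfrac12$ be real, and let $\lambda=(\lambda_1\ge\dots\ge\lambda_N\ge 0)$ be a partition with at most $N$ parts. *Notation.* $s_{jk}$ exchanges the variables number $j$ and $k$, and $t_j$ changes the sign of the variable number $j$. $m_\mu$ is the monomial symmetric polynomial in $N$ variables, and $m_\mu(z^2)=m_\mu(z_1^2,\dots,z_N^2)$. For partitions with at most $N$ parts, write $\mu<\lambda$ if $\mu\ne\lambda$ and $\mu_1+\dots+\mu_k\le\lambda_1+\dots+\lambda_k$ for all $1\le k\le N$ (the weights $|\mu|=\sum_i\mu_i$ and $|\lambda|$ may differ). *Jack polynomials.* On $\mathbb C[x_1,\dots,x_N]$ put $$D^A_j=\frac{\partial}{\partial x_j}+\beta\sum_{k\ne j}\frac{1-s_{jk}}{x_j-x_k},\qquad \hat D^A_j=x_jD^A_j+\beta\sum_{k<j}s_{jk},\qquad \widetilde{\mathcal H}_s=\sum_{j=1}^N\Big(\hat D^A_j-\tfrac{\beta}{2}(N-1)\Big)^2 .$$ The symmetric Jack polynomial $J^{(\beta)}_\lambda$ is characterized by: (i) $J^{(\beta)}_\lambda-m_\lambda$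 is a linear combination of the $m_\mu$ with $\mu<\lambda$ and $|\mu|=|\lambda|$; (ii) $J^{(\beta)}_\lambda$ is an eigenfunction of $\widetilde{\mathcal H}_s$. *Laguerre polynomials.* For $f,g\in\mathbb C[z_1,\dots,z_N]$ put $$\langle f,g\rangle=\int_{\mathbb R^N}f(z)\,g(z)\,\phi(z)^2\,dz,\qquad \phi(z)=\prod_{j<k}|z_j^2-z_k^2|^{\beta}\prod_{j=1}^N|z_j|^{\gamma}e^{-z_j^2/2}.$$ The multivariable Laguerre polynomial $L^{(\beta)}_\lambda\in\mathbb C[z_1,\dots,z_N]$ is characterized by: (i) $L^{(\beta)}_\lambda-m_\lambda(z^2)$ is a linear combination of the $m_\mu(z^2)$ with $\mu<\lambda$; (ii) $\langle L^{(\beta)}_\lambda,m_\mu(z^2)\rangle=0$ for all $\mu<\lambda$. *Creation operators.* On $\mathbb C[z_1,\dots,z_N]$ put $$D^B_j=\frac{\partial}{\partial z_j}+\beta\sum_{k\ne j}\Big(\frac{1-s_{jk}}{z_j-z_k}+\frac{1-t_jt_ks_{jk}}{z_j+z_k}\Big)+\gamma\,\frac{1-t_j}{z_j},\qquad \tilde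 b^\dagger_j=\frac1{\sqrt2}\big(-D^B_j+2z_j\big).$$ The operators $\tilde b_j^\dagger$ commute. For $f\in\mathbb C[x_1,\dots,x_N]$ let $\sigma^B(f)=f\big((\tilde b_1^\dagger)^2/2,\dots,(\tilde b_N^\dagger)^2/2\big)\cdot 1$. **Proposition.** The integrals $\langle f,g\rangle$ converge absolutely for all $f,g\in\mathbb C[z_1,\dots,z_N]$, each of the polynomials $J^{(\beta)}_\lambda$ and $L^{(\beta)}_\lambda$ exists and is uniquely determined by its properties (i), (ii), and $$L^{(\beta)}_\lambda(z)=\sigma^B\big(J^{(\beta)}_\lambda\big)=J^{(\beta)}_\lambda\big((\tilde b^\dagger)^2/2\big)\cdot 1 .$$ -/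

import Mathlib

open MeasureTheory

noncomputable section

namespace CalogeroLaguerre

/-- The polynomial ring `ℂ[x₁, …, x_N]` (also used for `ℂ[z₁, …, z_N]`). -/
abbrev Poly (N : ℕ) : Type := MvPolynomial (Fin N) ℂ

variable {N : ℕ}

/-! ### Reflections and divided differences -/

/-- `s_{jk}`: exchange of the variables number `j` and `k`. -/
def exch (j k : Fin N) : Poly N →ₐ[ℂ] Poly N :=
  MvPolynomial.rename (Equiv.swap j k)

/-- `t_j`: sign change of the variable number `j`. -/
def signChange (j : Fin N) : Poly N →ₐ[ℂ] Poly N :=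
  MvPolynomial.aeval fun i => if i = j then -MvPolynomial.X i else MvPolynomial.X i

/-- `t_j t_k s_{jk}`. -/
def signedExch (j k : Fin N) : Poly N →ₐ[ℂ] Poly N :=
  ((signChange j).comp (signChange k)).comp (exch j k)

theorem dvd_sub_apply (φ : Poly N →ₐ[ℂ] Poly N) (p : Poly N)
    (h : ∀ i, p ∣ MvPolynomial.X i - φ (MvPolynomial.X i)) (f : Poly N) : p ∣ f - φ f := by
  induction f using MvPolynomial.induction_on with
  | C a => rw [← MvPolynomial.algebraMap_eq, AlgHom.commutes, sub_self]; exact dvd_zero p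
  | add f g hf hg =>
    have e : f + g - φ (f + g) = (f - φ f) + (g - φ g) := by rw [map_add]; ring
    rw [e]; exact dvd_add hf hg
  | mul_X f i hf =>
    have e : f * MvPolynomial.X i - φ (f * MvPolynomial.X i)
        = (f - φ f) * MvPolynomial.X i
          + φ f * (MvPolynomial.X i - φ (MvPolynomial.X i)) := by rw [map_mul]; ring
    rw [e]; exact dvd_add (dvd_mul_of_dvd_left hf _) (dvd_mul_of_dvd_right (h i) _)

/-- The operator `p⁻¹ (1 - φ)` on polynomials: `f` is sent to the unique polynomial `q` with
`p q = f - φ f`. -/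
def divDiff (φ : Poly N →ₐ[ℂ] Poly N) (p : Poly N) (hp : p ≠ 0)
    (h : ∀ i, p ∣ MvPolynomial.X i - φ (MvPolynomial.X i)) : Module.End ℂ (Poly N) where
  toFun f := Classical.choose (dvd_sub_apply φ p h f)
  map_add' f g := by
    apply mul_left_cancel₀ hp
    rw [mul_add, ← Classical.choose_spec (dvd_sub_apply φ p h (f + g)),
      ← Classical.choose_spec (dvd_sub_apply φ p h f),
      ← Classical.choose_spec (dvd_sub_apply φ p h g), map_add]
    ring
  map_smul' c f := by
    apply mul_left_cancel₀ hp
    rw [RingHom.id_apply, mul_smul_comm,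
      ← Classical.choose_spec (dvd_sub_apply φ p h (c • f)),
      ← Classical.choose_spec (dvd_sub_apply φ p h f), map_smul, smul_sub]

theorem mul_divDiff (φ : Poly N →ₐ[ℂ] Poly N) (p : Poly N) (hp : p ≠ 0)
    (h : ∀ i, p ∣ MvPolynomial.X i - φ (MvPolynomial.X i)) (f : Poly N) :
    p * divDiff φ p hp h f = f - φ f :=
  (Classical.choose_spec (dvd_sub_apply φ p h f)).symm

theorem X_sub_X_ne_zero {j k : Fin N} (h : k ≠ j) :
    (MvPolynomial.X j - MvPolynomial.X k : Poly N) ≠ 0 := fun e =>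
  h (MvPolynomial.X_injective (sub_eq_zero.mp e)).symm

theorem X_add_X_ne_zero {j k : Fin N} (h : k ≠ j) :
    (MvPolynomial.X j + MvPolynomial.X k : Poly N) ≠ 0 := fun e => by
  have := congrArg (MvPolynomial.eval fun i => if i = j then (1 : ℂ) else 0) e
  simp [h] at this

theorem dvd_exch (j k i : Fin N) : (MvPolynomial.X j - MvPolynomial.X k : Poly N) ∣
    MvPolynomial.X i - exch j k (MvPolynomial.X i) := by
  unfold exch
  rw [MvPolynomial.rename_X]
  rcases eq_or_ne i j with rfl | hj
  · rw [Equiv.swap_apply_left]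
  · rcases eq_or_ne i k with rfl | hk
    · rw [Equiv.swap_apply_right]; exact ⟨-1, by ring⟩
    · rw [Equiv.swap_apply_of_ne_of_ne hj hk, sub_self]; exact dvd_zero _

theorem dvd_signedExch {j k : Fin N} (h : k ≠ j) (i : Fin N) :
    (MvPolynomial.X j + MvPolynomial.X k : Poly N) ∣
      MvPolynomial.X i - signedExch j k (MvPolynomial.X i) := by
  rcases eq_or_ne i j with rfl | hj
  · simp [signedExch, exch, signChange, h]
  · rcases eq_or_ne i k with rfl | hk
    · simp [signedExch, exch, signChange, h.symm, add_comm]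
    · simp [signedExch, exch, signChange, Equiv.swap_apply_of_ne_of_ne hj hk, hj, hk]

theorem dvd_signChange (j i : Fin N) :
    (MvPolynomial.X j : Poly N) ∣ MvPolynomial.X i - signChange j (MvPolynomial.X i) := by
  rcases eq_or_ne i j with rfl | hj
  · have e : (MvPolynomial.X i : Poly N) - signChange i (MvPolynomial.X i)
        = MvPolynomial.X i * 2 := by simp [signChange]; ring
    rw [e]; exact dvd_mul_right _ _
  · simp [signChange, hj]

/-- Partial derivative in the variable number `j`. -/
def del (j : Fin N) : Module.End ℂ (Poly N) := (MvPolynomial.pderiv j).toLinearMap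

/-- Multiplication by the variable number `j`. -/
def mulVar (j : Fin N) : Module.End ℂ (Poly N) := LinearMap.mulLeft ℂ (MvPolynomial.X j)

/-! ### Symmetric functions and dominance -/

/-- The monomial symmetric polynomial `m_μ`, the sum of all distinct monomials
`x₁ ^ α₁ ⋯ x_N ^ α_N` with `α` a rearrangement of `μ`. -/
def mono (μ : Fin N → ℕ) : Poly N :=
  ∑ α ∈ Finset.univ.image (fun w : Equiv.Perm (Fin N) => μ ∘ w),
    MvPolynomial.monomial (Finsupp.equivFunOnFinite.symm α) 1

/-- `μ` is strictly below `lam` in the order given by comparison of all partial sums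
`μ₁ + ⋯ + μ_k ≤ lam₁ + ⋯ + lam_k`, `k = 1, …, N`; the total sums may differ. -/
def DomLT (μ lam : Fin N → ℕ) : Prop :=
  (∀ k, ∑ i ∈ Finset.Iic k, μ i ≤ ∑ i ∈ Finset.Iic k, lam i) ∧ μ ≠ lam

/-! ### Jack polynomials -/

/-- The Dunkl operator `D^A_j`. -/
def dunklA (β : ℕ) (j : Fin N) : Module.End ℂ (Poly N) :=
  del j + (β : ℂ) • ∑ k : {k : Fin N // k ≠ j},
    divDiff (exch j k) (MvPolynomial.X j - MvPolynomial.X k.1)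
      (X_sub_X_ne_zero k.2) (dvd_exch j k)

/-- The Cherednik operator `x_j D^A_j + β ∑_{k < j} s_{jk}`. -/
def cherednikA (β : ℕ) (j : Fin N) : Module.End ℂ (Poly N) :=
  mulVar j * dunklA β j + (β : ℂ) • ∑ k ∈ Finset.Iio j, (exch j k).toLinearMap

/-- The gauge-transformed Sutherland Hamiltonian, `∑_j (D̂^A_j - β (N - 1) / 2) ^ 2`
(to be applied to symmetric polynomials). -/
def sutherland (N β : ℕ) : Module.End ℂ (Poly N) :=
  ∑ j : Fin N, (cherednikA β j - ((β : ℂ) / 2 * ((N : ℂ) - 1)) • 1) ^ 2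

/-- `J` is the symmetric Jack polynomial `J_lam^{(β)}`: it is `m_lam` plus a linear combination of
`m_μ` with `μ` a partition strictly below `lam` in the dominance order of partitions of equal
weight, and it is an eigenfunction of the gauge-transformed Sutherland Hamiltonian. -/
def IsJack (β : ℕ) (lam : Fin N → ℕ) (J : Poly N) : Prop :=
  (J - mono lam ∈ Submodule.span ℂ
    (mono '' {μ : Fin N → ℕ | Antitone μ ∧ DomLT μ lam ∧ ∑ i, μ i = ∑ i, lam i})) ∧
  ∃ c : ℂ, sutherland N β J = c • J

/-! ### Laguerre polynomials -/

/-- The Dunkl operator `D^B_j`. -/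
def dunklB (β : ℕ) (γ : ℝ) (j : Fin N) : Module.End ℂ (Poly N) :=
  del j
  + (β : ℂ) • ∑ k : {k : Fin N // k ≠ j},
      (divDiff (exch j k) (MvPolynomial.X j - MvPolynomial.X k.1)
          (X_sub_X_ne_zero k.2) (dvd_exch j k)
        + divDiff (signedExch j k) (MvPolynomial.X j + MvPolynomial.X k.1)
          (X_add_X_ne_zero k.2) (dvd_signedExch k.2))
  + (γ : ℂ) • divDiff (signChange j) (MvPolynomial.X j)
      (MvPolynomial.X_ne_zero j) (dvd_signChange j)

/-- The creation operator `(-D^B_j + z_j) / √2` conjugated by `∏_k exp (-z_k² / 2)`. As this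
Gaussian is invariant under all reflections, only the derivative is affected (it becomes
`∂_j - z_j`), and the result is `(-D^B_j + 2 z_j) / √2`. -/
def creation (β : ℕ) (γ : ℝ) (j : Fin N) : Module.End ℂ (Poly N) :=
  ((Real.sqrt 2 : ℝ) : ℂ)⁻¹ • (-dunklB β γ j + (2 : ℂ) • mulVar j)

/-- `σ^B (f) = f (b₁² / 2, …, b_N² / 2) · 1`, with `b_j` the creation operators. These commute;
the products are written in the order of the indices. -/
def sigmaB (β : ℕ) (γ : ℝ) (f : Poly N) : Poly N :=
  ∑ m ∈ f.support, f.coeff m •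
    (List.ofFn fun j : Fin N => ((2 : ℂ)⁻¹ • creation β γ j ^ 2) ^ m j).prod 1

/-- The ground state `∏_{j<k} |z_j² - z_k²| ^ β ∏_j |z_j| ^ γ exp (-z_j² / 2)`. -/
def groundState (β : ℕ) (γ : ℝ) (z : Fin N → ℝ) : ℝ :=
  (∏ j : Fin N, ∏ k ∈ Finset.Ioi j, |z j ^ 2 - z k ^ 2| ^ β) *
    ∏ j : Fin N, |z j| ^ γ * Real.exp (-(z j) ^ 2 / 2)

/-- The integrand of the scalar product. -/
def integrandB (β : ℕ) (γ : ℝ) (f g : Poly N) (z : Fin N → ℝ) : ℂ :=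
  MvPolynomial.eval (fun i => (z i : ℂ)) f * MvPolynomial.eval (fun i => (z i : ℂ)) g *
    ((groundState β γ z ^ 2 : ℝ) : ℂ)

/-- The scalar product of the `B_N` Calogero model. -/
def scalarB (β : ℕ) (γ : ℝ) (f g : Poly N) : ℂ := ∫ z : Fin N → ℝ, integrandB β γ f g z

/-- `m_μ (z²)`. -/
def monoSq (μ : Fin N → ℕ) : Poly N := MvPolynomial.expand 2 (mono μ)

/-- `L` is the multivariable Laguerre polynomial `L_lam^{(β)}`. -/
def IsLaguerre (β : ℕ) (γ : ℝ) (lam : Fin N → ℕ) (L : Poly N) : Prop :=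
  (L - monoSq lam ∈ Submodule.span ℂ
    (monoSq '' {μ : Fin N → ℕ | Antitone μ ∧ DomLT μ lam})) ∧
  ∀ μ : Fin N → ℕ, Antitone μ → DomLT μ lam → scalarB β γ L (monoSq μ) = 0

end CalogeroLaguerre

end

noncomputable section

namespace CalogeroLaguerre

open MvPolynomial

variable {N : ℕ}

/-! ### Divided differences -/

/-! Write `D_j` for the type `B` Dunkl operators and `Δ = ∑ D_j²`. Half the square of a creation
operator is `(X_j - D_j / 2)²`, so `sigmaB f = G (f (z²))` with `G f = f (X - D / 2) · 1` (`gaussT`,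
`sigmaB_eq_gaussT`). By construction `G X_j = (X_j - D_j / 2) G`. Moreover `G` commutes with
reflections and Dunkl operators (`dunklB_gaussT`), and `G = exp (-Δ / 4)` (`gaussT_eq_sum`).

For the scalar product the adjoint of `D_j` is `2 (X_j - D_j / 2)` (`gInt_dunklB_mul`). Hence for
the form `⟨G f, G g⟩` multiplication by `X_j` is adjoint to `D_j / 2`, and `X_j D_j` is
self-adjoint. On even polynomials `X_j D_j` is twice `x_j D^A_j` with `x = z²`. So the Euler
operator `∑ x_j D^A_j` and the Sutherland operator are self-adjoint for `⟨sigmaB f, sigmaB g⟩`.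

If `μ < lam`, the Jack polynomials of `μ` and `lam` have different eigenvalues for one of these: the
Euler operator if the weights differ, the Sutherland operator if they agree (`jackEigenvalue_lt`).
Their images under `sigmaB` are therefore orthogonal (`evenForm_isJack_eq_zero`). Since `Δ` respects
dominance and lowers degree, `sigmaB J` is `m_lam (z²)` plus lower terms (`sigmaB_isJack_mem`).
Induction along dominance then gives orthogonality to every lower `m_μ (z²)`, so `sigmaB J` is a
Laguerre polynomial. Positivity of the weight makes that polynomial unique (`IsLaguerre.unique`).

Jack polynomials exist and are unique because the Sutherland operator is triangular on the `m_μ`,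
with diagonal entries strictly increasing along dominance in fixed weight (`existsUnique_isJack`).

As `β` is an integer, the squared ground state is, up to a constant sign, a polynomial times a
product of one-variable weights. Integration thus reduces to an algebraic functional given by
moments (`scalarB_eq`). -/

theorem divDiff_mul (φ : Poly N →ₐ[ℂ] Poly N) (p : Poly N) (hp : p ≠ 0)
    (h : ∀ i, p ∣ X i - φ (X i)) (f g : Poly N) :
    divDiff φ p hp h (f * g) = f * divDiff φ p hp h g + divDiff φ p hp h f * φ g := by
  apply mul_left_cancel₀ hp
  rw [mul_add, mul_left_comm, ← mul_assoc p (divDiff φ p hp h f), mul_divDiff, mul_divDiff,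
    mul_divDiff, map_mul]
  ring

@[simp] theorem exch_self (j : Fin N) (f : Poly N) : exch j j f = f := by
  simp [exch]

theorem exch_comm (j k : Fin N) : exch j k = exch k j := by
  simp [exch, Equiv.swap_comm]

@[simp] theorem exch_X (j k i : Fin N) : exch j k (X i) = X (Equiv.swap j k i) := by
  simp [exch]

@[simp] theorem exch_exch (j k : Fin N) (f : Poly N) : exch j k (exch j k f) = f := by
  have : (exch j k).comp (exch j k) = AlgHom.id ℂ _ := by
    apply algHom_ext; intro i; simp
  exact DFunLike.congr_fun this f

@[simp] theorem signChange_X (j i : Fin N) :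
    signChange j (X i) = if i = j then -X i else X i := by
  simp [signChange]

@[simp] theorem signChange_signChange (j : Fin N) (f : Poly N) :
    signChange j (signChange j f) = f := by
  have : (signChange j).comp (signChange j) = AlgHom.id ℂ _ := by
    apply algHom_ext; intro i
    by_cases h : i = j <;> simp [h]
  exact DFunLike.congr_fun this f

theorem signChange_comm (i j : Fin N) (f : Poly N) :
    signChange i (signChange j f) = signChange j (signChange i f) := by
  have : (signChange i).comp (signChange j) = (signChange j).comp (signChange i) := by
    apply algHom_ext; intro k
    by_cases h : k = j <;> by_cases h' : k = i <;> simp [h, h'] <;> simp_all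
  exact DFunLike.congr_fun this f

theorem signedExch_apply (j k : Fin N) (f : Poly N) :
    signedExch j k f = signChange j (signChange k (exch j k f)) := rfl

theorem signedExch_comm (j k : Fin N) : signedExch j k = signedExch k j := by
  apply AlgHom.ext; intro f
  rw [signedExch_apply, signedExch_apply, signChange_comm, exch_comm]

@[simp] theorem signedExch_self (j : Fin N) (f : Poly N) : signedExch j j f = f := by
  simp [signedExch_apply]

theorem rename_exch (e : Equiv.Perm (Fin N)) (j k : Fin N) (f : Poly N) :
    rename e (exch j k f) = exch (e j) (e k) (rename e f) := by
  have : (rename e).comp (exch j k) = (exch (e j) (e k)).comp (rename e) := by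
    apply algHom_ext; intro i
    simp only [AlgHom.comp_apply, exch_X, rename_X]
    simp only [Equiv.swap_apply_def, e.injective.eq_iff]
    split_ifs <;> rfl
  exact DFunLike.congr_fun this f

theorem rename_signChange (e : Equiv.Perm (Fin N)) (j : Fin N) (f : Poly N) :
    rename e (signChange j f) = signChange (e j) (rename e f) := by
  have : (rename e).comp (signChange j) = (signChange (e j)).comp (rename e) := by
    apply algHom_ext; intro i
    by_cases h : i = j <;> simp [h]
  exact DFunLike.congr_fun this f

theorem rename_signedExch (e : Equiv.Perm (Fin N)) (j k : Fin N) (f : Poly N) :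
    rename e (signedExch j k f) = signedExch (e j) (e k) (rename e f) := by
  simp only [signedExch_apply, rename_signChange, rename_exch]

theorem exch_signChange_left (j k : Fin N) (f : Poly N) :
    exch j k (signChange j f) = signChange k (exch j k f) := by
  have := rename_signChange (Equiv.swap j k) j f
  rwa [Equiv.swap_apply_left] at this

theorem exch_signChange_right (j k : Fin N) (f : Poly N) :
    exch j k (signChange k f) = signChange j (exch j k f) := by
  have := rename_signChange (Equiv.swap j k) k f
  rwa [Equiv.swap_apply_right] at this

theorem exch_signChange_of_ne {i j k : Fin N} (hj : i ≠ j) (hk : i ≠ k) (f : Poly N) :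
    exch j k (signChange i f) = signChange i (exch j k f) := by
  have := rename_signChange (Equiv.swap j k) i f
  rwa [Equiv.swap_apply_of_ne_of_ne hj hk] at this

theorem signChange_exch_left (j k : Fin N) (f : Poly N) :
    signChange j (exch j k f) = signedExch j k (signChange j f) := by
  rw [signedExch_apply, exch_signChange_left, signChange_signChange]

theorem signChange_exch_right (j k : Fin N) (f : Poly N) :
    signChange k (exch j k f) = signedExch j k (signChange k f) := by
  rw [signedExch_apply, exch_signChange_right, signChange_comm k j, signChange_signChange]

theorem signChange_signedExch_left (j k : Fin N) (f : Poly N) :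
    signChange j (signedExch j k f) = exch j k (signChange j f) := by
  rw [signedExch_apply, exch_signChange_left, signChange_signChange]

theorem signChange_signedExch_right (j k : Fin N) (f : Poly N) :
    signChange k (signedExch j k f) = exch j k (signChange k f) := by
  rw [signedExch_apply, exch_signChange_right, signChange_comm, signChange_comm k,
    signChange_signChange]

theorem signChange_signedExch_of_ne {i j k : Fin N} (hj : i ≠ j) (hk : i ≠ k) (f : Poly N) :
    signChange i (signedExch j k f) = signedExch j k (signChange i f) := by
  rw [signedExch_apply, signedExch_apply, exch_signChange_of_ne hj hk, signChange_comm i j,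
    signChange_comm i k]

/-- The divided difference `(X_j - X_k)⁻¹ (1 - s_{jk})`, extended by `0` to `j = k`. -/
def ddA (j k : Fin N) : Module.End ℂ (Poly N) :=
  if h : k ≠ j then divDiff (exch j k) (X j - X k) (X_sub_X_ne_zero h) (dvd_exch j k) else 0

/-- The divided difference `(X_j + X_k)⁻¹ (1 - t_j t_k s_{jk})`, extended by `0` to `j = k`. -/
def ddB (j k : Fin N) : Module.End ℂ (Poly N) :=
  if h : k ≠ j then
    divDiff (signedExch j k) (X j + X k) (X_add_X_ne_zero h) (dvd_signedExch h) else 0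

/-- The divided difference `X_j⁻¹ (1 - t_j)`. -/
def ddT (j : Fin N) : Module.End ℂ (Poly N) :=
  divDiff (signChange j) (X j) (X_ne_zero j) (dvd_signChange j)

@[simp] theorem ddA_self (j : Fin N) : ddA j j = 0 := by simp [ddA]

@[simp] theorem ddB_self (j : Fin N) : ddB j j = 0 := by simp [ddB]

theorem mul_ddA (j k : Fin N) (f : Poly N) : (X j - X k) * ddA j k f = f - exch j k f := by
  by_cases h : k = j
  · subst h; simp
  · rw [ddA, dif_pos h, mul_divDiff]

theorem mul_ddB (j k : Fin N) (f : Poly N) : (X j + X k) * ddB j k f = f - signedExch j k f := by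
  by_cases h : k = j
  · subst h; simp
  · rw [ddB, dif_pos h, mul_divDiff]

theorem mul_ddT (j : Fin N) (f : Poly N) : X j * ddT j f = f - signChange j f :=
  mul_divDiff _ _ _ _ f

theorem ddA_mul (j k : Fin N) (f g : Poly N) :
    ddA j k (f * g) = f * ddA j k g + ddA j k f * exch j k g := by
  by_cases h : k = j
  · subst h; simp
  · rw [ddA, dif_pos h, divDiff_mul]

theorem ddB_mul (j k : Fin N) (f g : Poly N) :
    ddB j k (f * g) = f * ddB j k g + ddB j k f * signedExch j k g := by
  by_cases h : k = j
  · subst h; simp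
  · rw [ddB, dif_pos h, divDiff_mul]

theorem ddT_mul (j : Fin N) (f g : Poly N) :
    ddT j (f * g) = f * ddT j g + ddT j f * signChange j g :=
  divDiff_mul _ _ _ _ f g

theorem ddA_X_left {j k : Fin N} (h : k ≠ j) : ddA j k (X j) = 1 := by
  apply mul_left_cancel₀ (X_sub_X_ne_zero h)
  rw [mul_ddA]; simp

theorem ddA_X_right {j k : Fin N} (h : k ≠ j) : ddA j k (X k) = -1 := by
  apply mul_left_cancel₀ (X_sub_X_ne_zero h)
  rw [mul_ddA]; simp

theorem ddA_X_of_ne {i j k : Fin N} (hj : i ≠ j) (hk : i ≠ k) : ddA j k (X i) = 0 := by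
  by_cases h : k = j
  · subst h; simp
  apply mul_left_cancel₀ (X_sub_X_ne_zero h)
  rw [mul_ddA]; simp [Equiv.swap_apply_of_ne_of_ne hj hk]

theorem ddB_X_left {j k : Fin N} (h : k ≠ j) : ddB j k (X j) = 1 := by
  apply mul_left_cancel₀ (X_add_X_ne_zero h)
  rw [mul_ddB]; simp [signedExch_apply, h]

theorem ddB_X_right {j k : Fin N} (h : k ≠ j) : ddB j k (X k) = 1 := by
  apply mul_left_cancel₀ (X_add_X_ne_zero h)
  rw [mul_ddB]; simp [signedExch_apply, h.symm]; ring

theorem ddB_X_of_ne {i j k : Fin N} (hj : i ≠ j) (hk : i ≠ k) : ddB j k (X i) = 0 := by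
  by_cases h : k = j
  · subst h; simp
  apply mul_left_cancel₀ (X_add_X_ne_zero h)
  rw [mul_ddB]; simp [signedExch_apply, Equiv.swap_apply_of_ne_of_ne hj hk, hj, hk]

theorem ddT_X_self (j : Fin N) : ddT j (X j) = 2 := by
  apply mul_left_cancel₀ (X_ne_zero j)
  rw [mul_ddT]; simp; ring

theorem ddT_X_of_ne {i j : Fin N} (h : i ≠ j) : ddT j (X i) = 0 := by
  apply mul_left_cancel₀ (X_ne_zero j)
  rw [mul_ddT]; simp [h]

theorem ddA_one (j k : Fin N) : ddA j k 1 = 0 := by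
  by_cases h : k = j
  · subst h; simp
  apply mul_left_cancel₀ (X_sub_X_ne_zero h)
  rw [mul_ddA]; simp

theorem ddB_one (j k : Fin N) : ddB j k 1 = 0 := by
  by_cases h : k = j
  · subst h; simp
  apply mul_left_cancel₀ (X_add_X_ne_zero h)
  rw [mul_ddB]; simp

theorem ddT_one (j : Fin N) : ddT j 1 = 0 := by
  apply mul_left_cancel₀ (X_ne_zero j)
  rw [mul_ddT]; simp

theorem rename_ddA (e : Equiv.Perm (Fin N)) (j k : Fin N) (f : Poly N) :
    rename e (ddA j k f) = ddA (e j) (e k) (rename e f) := by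
  by_cases h : k = j
  · subst h; simp
  apply mul_left_cancel₀ (X_sub_X_ne_zero (e.injective.ne h))
  rw [mul_ddA, ← rename_exch, ← map_sub, ← mul_ddA, map_mul, map_sub, rename_X, rename_X]

theorem rename_ddB (e : Equiv.Perm (Fin N)) (j k : Fin N) (f : Poly N) :
    rename e (ddB j k f) = ddB (e j) (e k) (rename e f) := by
  by_cases h : k = j
  · subst h; simp
  apply mul_left_cancel₀ (X_add_X_ne_zero (e.injective.ne h))
  rw [mul_ddB, ← rename_signedExch, ← map_sub, ← mul_ddB, map_mul, map_add, rename_X, rename_X]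

theorem rename_ddT (e : Equiv.Perm (Fin N)) (j : Fin N) (f : Poly N) :
    rename e (ddT j f) = ddT (e j) (rename e f) := by
  apply mul_left_cancel₀ (X_ne_zero (e j))
  rw [mul_ddT, ← rename_signChange, ← map_sub, ← mul_ddT, map_mul, rename_X]

/-- The sign by which `t_i` acts on the variable number `j`. -/
def flipSign (i j : Fin N) : ℂ := if i = j then -1 else 1

theorem flipSign_self (i : Fin N) : flipSign i i = -1 := by simp [flipSign]

theorem flipSign_of_ne {i j : Fin N} (h : i ≠ j) : flipSign i j = 1 := by simp [flipSign, h]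

/-- Only the sum is equivariant: up to sign, `t_j` and `t_k` interchange `z_j - z_k` with `z_j +
z_k`, and so the two divided differences. -/
theorem signChange_ddA_add_ddB (i j k : Fin N) (f : Poly N) :
    signChange i (ddA j k f + ddB j k f)
      = flipSign i j • (ddA j k (signChange i f) + ddB j k (signChange i f)) := by
  by_cases h : k = j
  · subst h; simp
  have hm := X_sub_X_ne_zero h
  have hp := X_add_X_ne_zero h
  have eA := congrArg (signChange i) (mul_ddA j k f)
  have eB := congrArg (signChange i) (mul_ddB j k f)
  have eA' := mul_ddA j k (signChange i f)
  have eB' := mul_ddB j k (signChange i f)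
  simp only [map_mul, map_sub, map_add, signChange_X] at eA eB
  rw [map_add]
  rcases eq_or_ne i j with rfl | hj
  · simp only [h, if_true, if_false] at eA eB
    rw [flipSign_self, neg_one_smul]
    rw [signChange_exch_left] at eA
    rw [signChange_signedExch_left] at eB
    have h1 : signChange i (ddA i k f) = -ddB i k (signChange i f) :=
      mul_left_cancel₀ hp (by linear_combination -eA + eB')
    have h2 : signChange i (ddB i k f) = -ddA i k (signChange i f) :=
      mul_left_cancel₀ hm (by linear_combination -eB + eA')
    rw [h1, h2]; ring
  · rw [flipSign_of_ne hj, one_smul]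
    rcases eq_or_ne i k with rfl | hk
    · simp only [hj.symm, if_true, if_false] at eA eB
      rw [signChange_exch_right] at eA
      rw [signChange_signedExch_right] at eB
      have h1 : signChange i (ddA j i f) = ddB j i (signChange i f) :=
        mul_left_cancel₀ hp (by linear_combination eA - eB')
      have h2 : signChange i (ddB j i f) = ddA j i (signChange i f) :=
        mul_left_cancel₀ hm (by linear_combination eB - eA')
      rw [h1, h2]; ring
    · simp only [hj.symm, hk.symm, if_false] at eA eB
      rw [← exch_signChange_of_ne hj hk] at eA
      rw [signChange_signedExch_of_ne hj hk] at eB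
      have h1 : signChange i (ddA j k f) = ddA j k (signChange i f) :=
        mul_left_cancel₀ hm (by linear_combination eA - eA')
      have h2 : signChange i (ddB j k f) = ddB j k (signChange i f) :=
        mul_left_cancel₀ hp (by linear_combination eB - eB')
      rw [h1, h2]

theorem signChange_ddT (i j : Fin N) (f : Poly N) :
    signChange i (ddT j f) = flipSign i j • ddT j (signChange i f) := by
  apply mul_left_cancel₀ (X_ne_zero j)
  rw [mul_smul_comm, mul_ddT, signChange_comm j, ← map_sub, ← mul_ddT, map_mul, signChange_X]
  rcases eq_or_ne i j with rfl | h
  · simp [flipSign_self]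
  · simp [flipSign_of_ne h, h.symm]

theorem signChange_pderiv (i j : Fin N) (f : Poly N) :
    signChange i (pderiv j f) = flipSign i j • pderiv j (signChange i f) := by
  induction f using MvPolynomial.induction_on with
  | C a => simp [← algebraMap_eq]
  | add f g hf hg => simp only [map_add, hf, hg, smul_add]
  | mul_X f k hf =>
    simp only [map_mul, Derivation.leibniz, smul_eq_mul, map_add, hf, signChange_X, pderiv_X]
    rcases eq_or_ne i j with rfl | h
    · rcases eq_or_ne k i with rfl | h'
      · simp [flipSign_self]
      · simp [flipSign_self, h']
    · rcases eq_or_ne k i with rfl | h'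
      · simp [flipSign_of_ne h, h]
      · simp [flipSign_of_ne h, h']
        by_cases h2 : k = j <;> simp [h2]

/-! ### Dunkl operators of type `B` -/

theorem sum_subtype_ne (j : Fin N) {M : Type*} [AddCommMonoid M] (f : Fin N → M) (h : f j = 0) :
    ∑ k : {k : Fin N // k ≠ j}, f k = ∑ k, f k := by
  rw [← Finset.sum_erase Finset.univ h]
  symm
  apply Finset.sum_subtype
  simp

theorem dunklB_eq (β : ℕ) (γ : ℝ) (j : Fin N) :
    dunklB β γ j = del j + (β : ℂ) • ∑ k, (ddA j k + ddB j k) + (γ : ℂ) • ddT j := by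
  rw [← sum_subtype_ne j _ (by simp), dunklB, ddT]
  congr 4
  ext1 k
  rw [ddA, ddB, dif_pos k.2, dif_pos k.2]

theorem dunklB_apply (β : ℕ) (γ : ℝ) (j : Fin N) (f : Poly N) :
    dunklB β γ j f = pderiv j f + (β : ℂ) • ∑ k, (ddA j k f + ddB j k f) + (γ : ℂ) • ddT j f := by
  simp [dunklB_eq, del, LinearMap.sum_apply]

theorem dunklB_one (β : ℕ) (γ : ℝ) (j : Fin N) : dunklB β γ j 1 = 0 := by
  simp [dunklB_apply, ddA_one, ddB_one, ddT_one]

theorem rename_dunklB (β : ℕ) (γ : ℝ) (e : Equiv.Perm (Fin N)) (j : Fin N) (f : Poly N) :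
    rename e (dunklB β γ j f) = dunklB β γ (e j) (rename e f) := by
  rw [dunklB_apply, dunklB_apply, map_add, map_add, map_smul, map_smul, map_sum,
    pderiv_rename e.injective, rename_ddT,
    ← Equiv.sum_comp e fun k => ddA (e j) k (rename e f) + ddB (e j) k (rename e f)]
  simp only [map_add, rename_ddA, rename_ddB]

theorem signChange_dunklB (β : ℕ) (γ : ℝ) (i j : Fin N) (f : Poly N) :
    signChange i (dunklB β γ j f) = flipSign i j • dunklB β γ j (signChange i f) := by
  rw [dunklB_apply, dunklB_apply, map_add, map_add, map_smul, map_smul, map_sum]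
  simp only [signChange_ddA_add_ddB, signChange_pderiv, signChange_ddT, ← Finset.smul_sum]
  rw [smul_add, smul_add, smul_comm (β : ℂ), smul_comm (γ : ℂ)]

/-- The commutator of `D^B_j` with multiplication by `X_k`. -/
def comDX (β : ℕ) (γ : ℝ) (j k : Fin N) (f : Poly N) : Poly N :=
  if j = k then
    f + (β : ℂ) • ∑ l ∈ Finset.univ.erase j, (exch j l f + signedExch j l f)
      + (2 * γ : ℂ) • signChange j f
  else -((β : ℂ) • (exch j k f - signedExch j k f))

/-- The commutator contains only the identity and reflections, so a further Dunkl operator passes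
through it by equivariance. This drives the inductions over monomials below. -/
theorem dunklB_X_mul (β : ℕ) (γ : ℝ) (j k : Fin N) (f : Poly N) :
    dunklB β γ j (X k * f) = X k * dunklB β γ j f + comDX β γ j k f := by
  rw [dunklB_apply, dunklB_apply, comDX]
  simp only [ddA_mul, ddB_mul, ddT_mul, Derivation.leibniz, smul_eq_mul, pderiv_X]
  have h0 : ∑ l, (X k * ddA j l f + ddA j l (X k) * exch j l f
        + (X k * ddB j l f + ddB j l (X k) * signedExch j l f))
      = X k * ∑ l, (ddA j l f + ddB j l f)
        + ∑ l, (ddA j l (X k) * exch j l f + ddB j l (X k) * signedExch j l f) := by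
    rw [Finset.mul_sum, ← Finset.sum_add_distrib]
    exact Finset.sum_congr rfl fun l _ => by ring
  rw [h0]
  split_ifs with h
  · subst h
    have h1 : ∑ l, (ddA j l (X j) * exch j l f + ddB j l (X j) * signedExch j l f)
        = ∑ l ∈ Finset.univ.erase j, (exch j l f + signedExch j l f) := by
      rw [← Finset.sum_erase (a := j) Finset.univ (by simp)]
      exact Finset.sum_congr rfl fun l hl => by
        rw [ddA_X_left (Finset.ne_of_mem_erase hl), ddB_X_left (Finset.ne_of_mem_erase hl)]; ring
    rw [h1, ddT_X_self]
    simp only [Pi.single_eq_same, smul_eq_C_mul, C_mul, map_ofNat]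
    ring
  · have h1 : ∑ l, (ddA j l (X k) * exch j l f + ddB j l (X k) * signedExch j l f)
        = -(exch j k f - signedExch j k f) := by
      rw [Finset.sum_eq_single k]
      · rw [ddA_X_right (Ne.symm h), ddB_X_right (Ne.symm h)]; ring
      · intro l _ hl
        rw [ddA_X_of_ne (Ne.symm h) hl.symm, ddB_X_of_ne (Ne.symm h) hl.symm]; ring
      · simp
    rw [h1, ddT_X_of_ne (Ne.symm h), Pi.single_apply, if_neg (Ne.symm h)]
    simp only [smul_eq_C_mul]
    ring

theorem comDX_comm (β : ℕ) (γ : ℝ) (j k : Fin N) : comDX β γ j k = comDX β γ k j := by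
  ext1 f
  by_cases h : j = k
  · rw [h]
  · rw [comDX, comDX, if_neg h, if_neg (Ne.symm h), exch_comm, signedExch_comm]

theorem dunklB_exch_left (β : ℕ) (γ : ℝ) (j k : Fin N) (f : Poly N) :
    dunklB β γ j (exch j k f) = exch j k (dunklB β γ k f) := by
  have := rename_dunklB β γ (Equiv.swap j k) k f
  rw [Equiv.swap_apply_right] at this
  exact this.symm

theorem dunklB_exch_of_ne (β : ℕ) (γ : ℝ) {i j k : Fin N} (hj : i ≠ j) (hk : i ≠ k) (f : Poly N) :
    dunklB β γ i (exch j k f) = exch j k (dunklB β γ i f) := by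
  have := rename_dunklB β γ (Equiv.swap j k) i f
  rw [Equiv.swap_apply_of_ne_of_ne hj hk] at this
  exact this.symm

theorem dunklB_signChange_self (β : ℕ) (γ : ℝ) (j : Fin N) (f : Poly N) :
    dunklB β γ j (signChange j f) = -signChange j (dunklB β γ j f) := by
  rw [signChange_dunklB, flipSign_self]; simp

theorem dunklB_signChange_of_ne (β : ℕ) (γ : ℝ) {i j : Fin N} (h : i ≠ j) (f : Poly N) :
    dunklB β γ i (signChange j f) = signChange j (dunklB β γ i f) := by
  rw [signChange_dunklB, flipSign_of_ne h.symm, one_smul]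

theorem dunklB_signedExch_left (β : ℕ) (γ : ℝ) {j k : Fin N} (h : j ≠ k) (f : Poly N) :
    dunklB β γ j (signedExch j k f) = -signedExch j k (dunklB β γ k f) := by
  rw [signedExch_apply, signedExch_apply, dunklB_signChange_self, dunklB_signChange_of_ne _ _ h,
    dunklB_exch_left]

theorem dunklB_signedExch_of_ne (β : ℕ) (γ : ℝ) {i j k : Fin N} (hj : i ≠ j) (hk : i ≠ k)
    (f : Poly N) : dunklB β γ i (signedExch j k f) = signedExch j k (dunklB β γ i f) := by
  rw [signedExch_apply, signedExch_apply, dunklB_signChange_of_ne _ _ hj,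
    dunklB_signChange_of_ne _ _ hk, dunklB_exch_of_ne _ _ hj hk]

theorem dunklB_signedExch_right (β : ℕ) (γ : ℝ) {j k : Fin N} (h : j ≠ k) (f : Poly N) :
    dunklB β γ k (signedExch j k f) = -signedExch j k (dunklB β γ j f) := by
  rw [signedExch_comm, dunklB_signedExch_left _ _ h.symm]

theorem dunklB_exch_right (β : ℕ) (γ : ℝ) (j k : Fin N) (f : Poly N) :
    dunklB β γ k (exch j k f) = exch j k (dunklB β γ j f) := by
  rw [exch_comm, dunklB_exch_left]

theorem dunklB_comDX_of_ne (β : ℕ) (γ : ℝ) {i j k : Fin N} (hij : i ≠ j) (hik : i ≠ k)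
    (hjk : j ≠ k) (f : Poly N) :
    dunklB β γ i (comDX β γ j k f) = comDX β γ j k (dunklB β γ i f) := by
  simp only [comDX, if_neg hjk, map_neg, map_smul, map_sub, dunklB_exch_of_ne _ _ hij hik,
    dunklB_signedExch_of_ne _ _ hij hik]

theorem dunklB_comDX_right (β : ℕ) (γ : ℝ) {i j : Fin N} (h : i ≠ j) (f : Poly N) :
    dunklB β γ j (comDX β γ i j f)
      = -((β : ℂ) • (exch i j (dunklB β γ i f) + signedExch i j (dunklB β γ i f))) := by
  simp only [comDX, if_neg h, map_neg, map_smul, map_sub, dunklB_exch_right,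
    dunklB_signedExch_right _ _ h, sub_neg_eq_add]

theorem dunklB_comDX_diag_of_ne (β : ℕ) (γ : ℝ) {i j : Fin N} (h : i ≠ j) (f : Poly N) :
    dunklB β γ i (comDX β γ j j f) = comDX β γ j j (dunklB β γ i f)
      + (β : ℂ) • (exch i j (dunklB β γ j f - dunklB β γ i f)
        - signedExch i j (dunklB β γ j f + dunklB β γ i f)) := by
  have key : ∑ l ∈ Finset.univ.erase j,
        (dunklB β γ i (exch j l f) + dunklB β γ i (signedExch j l f))
      = ∑ l ∈ Finset.univ.erase j,
          (exch j l (dunklB β γ i f) + signedExch j l (dunklB β γ i f))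
        + (exch i j (dunklB β γ j f - dunklB β γ i f)
          - signedExch i j (dunklB β γ j f + dunklB β γ i f)) := by
    rw [← sub_eq_iff_eq_add', ← Finset.sum_sub_distrib, Finset.sum_eq_single i]
    · rw [dunklB_exch_right, dunklB_signedExch_right _ _ h.symm, exch_comm i j,
        signedExch_comm i j, map_sub, map_add]
      ring
    · intro l hl hli
      rw [dunklB_exch_of_ne _ _ h hli.symm, dunklB_signedExch_of_ne _ _ h hli.symm, sub_self]
    · simp [h]
  simp only [comDX, if_true, map_add, map_smul, map_sum, dunklB_signChange_of_ne _ _ h]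
  rw [key]
  simp only [map_sub, map_add]
  module

/-- Constants are killed, so by induction on monomials it suffices that `[D_i, [D_j, X_k]]` is
symmetric in `i` and `j`. This is an identity among reflections, nontrivial only for `k ∈ {i, j}`.
-/
theorem dunklB_comm (β : ℕ) (γ : ℝ) (i j : Fin N) (f : Poly N) :
    dunklB β γ i (dunklB β γ j f) = dunklB β γ j (dunklB β γ i f) := by
  rcases eq_or_ne i j with rfl | hij
  · rfl
  have key : ∀ (i j : Fin N), i ≠ j → ∀ f, comDX β γ i j (dunklB β γ j f)
      + dunklB β γ i (comDX β γ j j f)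
      = comDX β γ j j (dunklB β γ i f) + dunklB β γ j (comDX β γ i j f) := by
    intro i j hij f
    rw [dunklB_comDX_diag_of_ne _ _ hij, dunklB_comDX_right _ _ hij, comDX, if_neg hij, map_sub,
      map_add]
    simp only [smul_add, smul_sub]
    abel
  induction f using MvPolynomial.induction_on with
  | C a =>
    rw [← mul_one (C a), ← smul_eq_C_mul]
    simp only [map_smul, dunklB_one, map_zero]
  | add f g hf hg => simp only [map_add, hf, hg]
  | mul_X f k hf =>
    rw [mul_comm]
    simp only [dunklB_X_mul, map_add, hf]
    suffices h : comDX β γ i k (dunklB β γ j f) + dunklB β γ i (comDX β γ j k f)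
        = comDX β γ j k (dunklB β γ i f) + dunklB β γ j (comDX β γ i k f) by
      linear_combination h
    rcases eq_or_ne k j with rfl | hkj
    · exact key _ _ hij f
    rcases eq_or_ne k i with rfl | hki
    · exact (key _ _ hij.symm f).symm
    rw [dunklB_comDX_of_ne _ _ hij hki.symm hkj.symm, dunklB_comDX_of_ne _ _ hij.symm hkj.symm
      hki.symm, add_comm]

/-- The Dunkl Laplacian of type `B`. -/
def dunklLaplace (N β : ℕ) (γ : ℝ) : Module.End ℂ (Poly N) :=
  ∑ j, dunklB β γ j ^ 2

theorem dunklLaplace_apply (β : ℕ) (γ : ℝ) (f : Poly N) :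
    dunklLaplace N β γ f = ∑ j, dunklB β γ j (dunklB β γ j f) := by
  simp [dunklLaplace, LinearMap.sum_apply, pow_two]

theorem dunklLaplace_X_mul (β : ℕ) (γ : ℝ) (k : Fin N) (f : Poly N) :
    dunklLaplace N β γ (X k * f) = X k * dunklLaplace N β γ f + (2 : ℂ) • dunklB β γ k f := by
  simp only [dunklLaplace_apply, dunklB_X_mul, map_add]
  have h1 : ∑ i, (X k * dunklB β γ i (dunklB β γ i f) + comDX β γ i k (dunklB β γ i f)
        + dunklB β γ i (comDX β γ i k f))
      = X k * ∑ i, dunklB β γ i (dunklB β γ i f)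
        + ∑ i, (comDX β γ i k (dunklB β γ i f) + dunklB β γ i (comDX β γ i k f)) := by
    rw [Finset.mul_sum, ← Finset.sum_add_distrib]
    exact Finset.sum_congr rfl fun i _ => by ring
  rw [h1, add_right_inj, ← Finset.add_sum_erase _ _ (Finset.mem_univ k)]
  -- In the term `i = k` the two `t_k` contributions cancel, as `D_k` anticommutes with `t_k`. The
  -- remaining reflections are cancelled by the terms `i = l ≠ k`.
  have h2 : comDX β γ k k (dunklB β γ k f) + dunklB β γ k (comDX β γ k k f)
      = (2 : ℂ) • dunklB β γ k f + (β : ℂ) • ∑ l ∈ Finset.univ.erase k,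
          (exch k l (dunklB β γ k f) + signedExch k l (dunklB β γ k f)
            + (exch k l (dunklB β γ l f) - signedExch k l (dunklB β γ l f))) := by
    have h3 : ∑ l ∈ Finset.univ.erase k,
          (dunklB β γ k (exch k l f) + dunklB β γ k (signedExch k l f))
        = ∑ l ∈ Finset.univ.erase k,
          (exch k l (dunklB β γ l f) - signedExch k l (dunklB β γ l f)) :=
      Finset.sum_congr rfl fun l hl => by
        rw [dunklB_exch_left, dunklB_signedExch_left _ _ (Finset.ne_of_mem_erase hl).symm,
          sub_eq_add_neg]
    rw [Finset.sum_add_distrib, ← h3]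
    simp only [comDX, if_true, map_add, map_smul, map_sum, dunklB_signChange_self]
    module
  rw [h2, add_assoc, add_eq_left, Finset.smul_sum, ← Finset.sum_add_distrib]
  refine Finset.sum_eq_zero fun l hl => ?_
  have hl := Finset.ne_of_mem_erase hl
  rw [comDX_comm β γ l k, dunklB_comDX_right _ _ hl.symm, comDX, if_neg hl.symm]
  module

theorem dunklLaplace_dunklB (β : ℕ) (γ : ℝ) (k : Fin N) (f : Poly N) :
    dunklLaplace N β γ (dunklB β γ k f) = dunklB β γ k (dunklLaplace N β γ f) := by
  simp only [dunklLaplace_apply, map_sum]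
  exact Finset.sum_congr rfl fun j _ => by rw [dunklB_comm β γ j k f, dunklB_comm]

theorem rename_dunklLaplace (β : ℕ) (γ : ℝ) (e : Equiv.Perm (Fin N)) (f : Poly N) :
    rename e (dunklLaplace N β γ f) = dunklLaplace N β γ (rename e f) := by
  simp only [dunklLaplace_apply, map_sum, rename_dunklB]
  exact Equiv.sum_comp e fun j => dunklB β γ j (dunklB β γ j (rename e f))

theorem dunklLaplace_pow_X_mul (β : ℕ) (γ : ℝ) (k : Fin N) (n : ℕ) (f : Poly N) :
    (dunklLaplace N β γ ^ (n + 1)) (X k * f) = X k * (dunklLaplace N β γ ^ (n + 1)) f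
      + (2 * (n + 1) : ℂ) • dunklB β γ k ((dunklLaplace N β γ ^ n) f) := by
  induction n with
  | zero => simp [dunklLaplace_X_mul]
  | succ n ih =>
    have h (m : ℕ) (g : Poly N) : (dunklLaplace N β γ ^ (m + 1)) g
        = dunklLaplace N β γ ((dunklLaplace N β γ ^ m) g) := by
      rw [pow_succ', Module.End.mul_apply]
    rw [h (n + 1), ih, map_add, dunklLaplace_X_mul, map_smul, dunklLaplace_dunklB, ← h, ← h n]
    push_cast
    module

/-! ### The transform `f ↦ f (b) · 1` -/

/-- The rescaled creation operator `X_j - D^B_j / 2`, whose square is `b_j² / 2`. -/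
def raising (β : ℕ) (γ : ℝ) (j : Fin N) : Module.End ℂ (Poly N) :=
  mulVar j - (2⁻¹ : ℂ) • dunklB β γ j

theorem raising_apply (β : ℕ) (γ : ℝ) (j : Fin N) (f : Poly N) :
    raising β γ j f = X j * f - (2⁻¹ : ℂ) • dunklB β γ j f := rfl

/-- `creation` is `√2` times `raising`; the square absorbs the root. -/
theorem half_creation_sq (β : ℕ) (γ : ℝ) (j : Fin N) :
    (2⁻¹ : ℂ) • creation β γ j ^ 2 = raising β γ j ^ 2 := by
  have h : creation β γ j = (((Real.sqrt 2 : ℝ) : ℂ)⁻¹ * 2) • raising β γ j := by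
    rw [creation, raising]; module
  have h2 : (((Real.sqrt 2 : ℝ) : ℂ)⁻¹) ^ 2 = 2⁻¹ := by
    rw [inv_pow, ← Complex.ofReal_pow, Real.sq_sqrt (by norm_num)]; norm_num
  rw [h, smul_pow, smul_smul, mul_pow, h2]
  norm_num

theorem raising_comm (β : ℕ) (γ : ℝ) (i j : Fin N) :
    raising β γ i * raising β γ j = raising β γ j * raising β γ i := by
  apply LinearMap.ext; intro f
  simp only [Module.End.mul_apply, raising_apply, map_sub, map_smul, dunklB_X_mul,
    dunklB_comm β γ i j, comDX_comm β γ i j, mul_left_comm (X i) (X j)]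
  module

open scoped IsMulCommutative in
/-- Substitution of the operators `X_j - D^B_j / 2` for the variables. -/
def raisingHom (N β : ℕ) (γ : ℝ) : Poly N →ₐ[ℂ] Module.End ℂ (Poly N) :=
  -- `aeval` needs a commutative target, so the substitution takes place in the subalgebra generated
  -- by the commuting operators.
  haveI : IsMulCommutative (Algebra.adjoin ℂ (Set.range (raising (N := N) β γ))) :=
    Algebra.isMulCommutative_adjoin ℂ (by
      rintro _ ⟨i, rfl⟩ _ ⟨j, rfl⟩; exact raising_comm β γ i j)
  (Algebra.adjoin ℂ (Set.range (raising (N := N) β γ))).val.comp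
    (aeval fun j => (⟨raising β γ j, Algebra.subset_adjoin ⟨j, rfl⟩⟩ :
      Algebra.adjoin ℂ (Set.range (raising (N := N) β γ))))

theorem raisingHom_X (β : ℕ) (γ : ℝ) (j : Fin N) : raisingHom N β γ (X j) = raising β γ j := by
  simp [raisingHom]

/-- The transform sending a polynomial `f` to `f (X - D^B / 2) · 1`. -/
def gaussT (N β : ℕ) (γ : ℝ) : Poly N →ₗ[ℂ] Poly N :=
  (LinearMap.applyₗ (1 : Poly N)).comp (raisingHom N β γ).toLinearMap

theorem gaussT_apply (β : ℕ) (γ : ℝ) (f : Poly N) :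
    gaussT N β γ f = raisingHom N β γ f 1 := rfl

theorem gaussT_C (β : ℕ) (γ : ℝ) (a : ℂ) : gaussT N β γ (C a) = C a := by
  rw [gaussT_apply, ← algebraMap_eq, AlgHom.commutes, Module.algebraMap_end_apply,
    Algebra.algebraMap_eq_smul_one]

/-- Together with `gaussT_C` this determines `gaussT`; its other properties follow by induction from
the two. -/
theorem gaussT_X_mul (β : ℕ) (γ : ℝ) (j : Fin N) (f : Poly N) :
    gaussT N β γ (X j * f) = raising β γ j (gaussT N β γ f) := by
  rw [gaussT_apply, map_mul, raisingHom_X]; rfl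

theorem sigmaB_eq_gaussT (β : ℕ) (γ : ℝ) (f : Poly N) :
    sigmaB β γ f = gaussT N β γ (expand 2 f) := by
  conv_rhs => rw [f.as_sum]
  rw [sigmaB, map_sum, map_sum]
  refine Finset.sum_congr rfl fun m _ => ?_
  have h : (monomial m (f.coeff m) : Poly N) = f.coeff m • (List.ofFn fun j => X j ^ m j).prod := by
    rw [monomial_eq, Finsupp.prod_fintype _ _ (by simp), List.prod_ofFn, smul_eq_C_mul]
  rw [h, map_smul, map_smul, gaussT_apply, map_list_prod, map_list_prod, List.map_ofFn,
    List.map_ofFn]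
  congr 4
  ext1 j
  simp [raisingHom_X, half_creation_sq]

theorem rename_raising (β : ℕ) (γ : ℝ) (e : Equiv.Perm (Fin N)) (j : Fin N) (f : Poly N) :
    rename e (raising β γ j f) = raising β γ (e j) (rename e f) := by
  simp only [raising_apply, map_sub, map_mul, map_smul, rename_X, rename_dunklB]

theorem signChange_raising (β : ℕ) (γ : ℝ) (i j : Fin N) (f : Poly N) :
    signChange i (raising β γ j f) = flipSign i j • raising β γ j (signChange i f) := by
  simp only [raising_apply, map_sub, map_mul, map_smul, signChange_X, signChange_dunklB]
  rcases eq_or_ne i j with rfl | h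
  · simp only [flipSign_self, if_true]
    rw [neg_mul]
    module
  · simp only [flipSign_of_ne h, h.symm, if_false, one_smul]

theorem rename_gaussT (β : ℕ) (γ : ℝ) (e : Equiv.Perm (Fin N)) (f : Poly N) :
    rename e (gaussT N β γ f) = gaussT N β γ (rename e f) := by
  induction f using MvPolynomial.induction_on with
  | C a => simp only [gaussT_C, rename_C]
  | add f g hf hg => simp only [map_add, hf, hg]
  | mul_X f k hf => rw [mul_comm, gaussT_X_mul, rename_raising, hf, map_mul, rename_X, gaussT_X_mul]

theorem exch_gaussT (β : ℕ) (γ : ℝ) (j k : Fin N) (f : Poly N) :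
    exch j k (gaussT N β γ f) = gaussT N β γ (exch j k f) :=
  rename_gaussT β γ (Equiv.swap j k) f

theorem signChange_gaussT (β : ℕ) (γ : ℝ) (i : Fin N) (f : Poly N) :
    signChange i (gaussT N β γ f) = gaussT N β γ (signChange i f) := by
  induction f using MvPolynomial.induction_on with
  | C a => rw [gaussT_C, ← algebraMap_eq, AlgHom.commutes, algebraMap_eq, gaussT_C]
  | add f g hf hg => simp only [map_add, hf, hg]
  | mul_X f k hf =>
    rw [mul_comm, gaussT_X_mul, signChange_raising, hf, map_mul, signChange_X]
    rcases eq_or_ne i k with rfl | h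
    · rw [if_pos rfl, neg_mul, map_neg, gaussT_X_mul, flipSign_self, neg_one_smul]
    · rw [if_neg h.symm, gaussT_X_mul, flipSign_of_ne h, one_smul]

theorem signedExch_gaussT (β : ℕ) (γ : ℝ) (j k : Fin N) (f : Poly N) :
    signedExch j k (gaussT N β γ f) = gaussT N β γ (signedExch j k f) := by
  simp only [signedExch_apply, exch_gaussT, signChange_gaussT]

theorem comDX_gaussT (β : ℕ) (γ : ℝ) (j k : Fin N) (f : Poly N) :
    comDX β γ j k (gaussT N β γ f) = gaussT N β γ (comDX β γ j k f) := by
  unfold comDX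
  split_ifs <;>
  simp only [map_add, map_neg, map_sub, map_smul, map_sum, exch_gaussT, signChange_gaussT,
    signedExch_gaussT]

/-- Since Dunkl operators commute, `D_j` has the same commutator with `raising β γ k` as with `X k`.
This commutator is made of reflections, which commute with `gaussT`. -/
theorem dunklB_gaussT (β : ℕ) (γ : ℝ) (j : Fin N) (f : Poly N) :
    dunklB β γ j (gaussT N β γ f) = gaussT N β γ (dunklB β γ j f) := by
  induction f using MvPolynomial.induction_on with
  | C a =>
    rw [gaussT_C, ← mul_one (C a), ← smul_eq_C_mul, map_smul, dunklB_one, smul_zero, map_zero]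
  | add f g hf hg => simp only [map_add, hf, hg]
  | mul_X f k hf =>
    rw [mul_comm, gaussT_X_mul, raising_apply, map_sub, map_smul, dunklB_comm, dunklB_X_mul,
      dunklB_X_mul, hf, map_add, gaussT_X_mul, raising_apply, comDX_gaussT]
    abel

/-- This is `exp (-Δ / 4)`: since `[Δ, X_k] = 2 D_k` commutes with `Δ`, conjugating `X_k` by the
exponential gives `X_k - D_k / 2`. -/
theorem gaussT_eq_sum (β : ℕ) (γ : ℝ) (f : Poly N) : ∃ K₀ : ℕ, ∀ K ≥ K₀,
    gaussT N β γ f = ∑ n ∈ Finset.range K,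
      (((-4 : ℂ)⁻¹) ^ n / (n.factorial : ℂ)) • (dunklLaplace N β γ ^ n) f := by
  induction f using MvPolynomial.induction_on with
  | C a =>
    refine ⟨1, fun K hK => ?_⟩
    obtain ⟨K, rfl⟩ : ∃ L, K = L + 1 := ⟨K - 1, by omega⟩
    rw [Finset.sum_range_succ', Finset.sum_eq_zero, gaussT_C]
    · simp
    · intro n _
      rw [pow_succ (dunklLaplace N β γ), Module.End.mul_apply, dunklLaplace_apply,
        Finset.sum_eq_zero, map_zero, smul_zero]
      intro i _
      rw [← mul_one (C a), ← smul_eq_C_mul, map_smul, dunklB_one, smul_zero, map_zero]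
  | add f g hf hg =>
    obtain ⟨K₁, h₁⟩ := hf
    obtain ⟨K₂, h₂⟩ := hg
    refine ⟨max K₁ K₂, fun K hK => ?_⟩
    rw [map_add, h₁ K (le_trans (le_max_left _ _) hK), h₂ K (le_trans (le_max_right _ _) hK),
      ← Finset.sum_add_distrib]
    simp only [map_add, smul_add]
  | mul_X f k hf =>
    obtain ⟨K₀, h⟩ := hf
    refine ⟨K₀ + 1, fun K hK => ?_⟩
    obtain ⟨K, rfl⟩ : ∃ L, K = L + 1 := ⟨K - 1, by omega⟩
    -- Truncations at `K + 1` (for `X_k * gaussT f`) and at `K` (for the Dunkl term) are both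
    -- needed, which is why the claim is made for all large `K`.
    have h1 := h (K + 1) (by omega)
    rw [Finset.sum_range_succ'] at h1
    rw [mul_comm, gaussT_X_mul, raising_apply, Finset.sum_range_succ',
      congrArg (dunklB β γ k) (h K (by omega)), h1]
    simp only [dunklLaplace_pow_X_mul, smul_add, Finset.sum_add_distrib, mul_add, Finset.mul_sum,
      mul_smul_comm, map_sum, map_smul, Finset.smul_sum, pow_zero, Module.End.one_apply]
    rw [sub_eq_add_neg, add_right_comm, ← Finset.sum_neg_distrib]
    congr 2
    refine Finset.sum_congr rfl fun n _ => ?_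
    rw [smul_smul, smul_smul, ← neg_smul]
    congr 1
    have : (n : ℂ) + 1 ≠ 0 := by exact_mod_cast n.succ_ne_zero
    have : (n.factorial : ℂ) ≠ 0 := by exact_mod_cast n.factorial_ne_zero
    rw [Nat.factorial_succ, pow_succ]
    push_cast
    field_simp
    norm_num

/-! ### The weight and its moments -/

/-- The one-variable weight `|x| ^ (2 γ) exp (-x²)`. -/
def weight (γ x : ℝ) : ℝ := (|x| ^ γ * Real.exp (-x ^ 2 / 2)) ^ 2

theorem weight_nonneg (γ x : ℝ) : 0 ≤ weight γ x := sq_nonneg _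

theorem weight_pos (γ : ℝ) {x : ℝ} (hx : x ≠ 0) : 0 < weight γ x := by
  have := Real.rpow_pos_of_pos (abs_pos.mpr hx) γ
  unfold weight; positivity

theorem weight_neg (γ x : ℝ) : weight γ (-x) = weight γ x := by simp [weight]

theorem weight_abs (γ x : ℝ) : weight γ |x| = weight γ x := by simp [weight]

theorem measurable_weight (γ : ℝ) : Measurable (weight γ) := by
  unfold weight; fun_prop

theorem pow_mul_weight (γ : ℝ) (n : ℕ) {x : ℝ} (hx : 0 < x) :
    x ^ n * weight γ x = x ^ (n + 2 * γ) * Real.exp (-1 * x ^ (2 : ℝ)) := by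
  have h2 : Real.exp (-x ^ 2 / 2) ^ 2 = Real.exp (-1 * x ^ (2 : ℝ)) := by
    rw [← Real.exp_nat_mul]; congr 1; rw [Real.rpow_two]; push_cast; ring
  rw [weight, abs_of_pos hx, mul_pow, h2, ← Real.rpow_mul_natCast hx.le, ← mul_assoc,
    ← Real.rpow_natCast x n, ← Real.rpow_add hx]
  congr 3; push_cast; ring

theorem integrable_of_even {f : ℝ → ℝ} (hf : ∀ x, f (-x) = f x)
    (h : IntegrableOn f (Set.Ioi 0)) : Integrable f := by
  rw [← integrableOn_univ, ← Set.Iic_union_Ioi (a := (0 : ℝ))]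
  refine IntegrableOn.union ?_ h
  rw [← Measure.map_neg_eq_self (volume : Measure ℝ)]
  let m : MeasurableEmbedding fun x : ℝ => -x := (Homeomorph.neg ℝ).measurableEmbedding
  rw [m.integrableOn_map_iff]
  simp_rw [Function.comp_def, hf, Set.neg_preimage, Set.neg_Iic, neg_zero]
  exact Iff.mpr integrableOn_Ici_iff_integrableOn_Ioi h

/-- The bound on `γ` says that the exponent `n + 2 γ` at the origin exceeds `-1` already for `n =
0`. -/
theorem integrable_pow_mul_weight {γ : ℝ} (hγ : -1 / 2 < γ) (n : ℕ) :
    Integrable fun x : ℝ => x ^ n * weight γ x := by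
  have h : Integrable fun x : ℝ => |x| ^ n * weight γ x := by
    refine integrable_of_even (by simp [weight_neg]) ?_
    have hs : (-1 : ℝ) < n + 2 * γ := by
      have : (0 : ℝ) ≤ n := n.cast_nonneg
      linarith
    refine (integrableOn_rpow_mul_exp_neg_mul_rpow hs two_pos one_pos).congr_fun ?_
      measurableSet_Ioi
    intro x hx
    rw [Set.mem_Ioi] at hx
    simp only [abs_of_pos hx, pow_mul_weight γ n hx]
  refine h.mono' ((measurable_id.pow_const n).mul (measurable_weight γ)).aestronglyMeasurable
    (Filter.Eventually.of_forall fun x => ?_)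
  simp [abs_of_nonneg (weight_nonneg γ x)]

/-- The moments of the weight. -/
def moment (γ : ℝ) (n : ℕ) : ℝ := ∫ x : ℝ, x ^ n * weight γ x

theorem moment_odd (γ : ℝ) {n : ℕ} (hn : Odd n) : moment γ n = 0 := by
  have h := integral_neg_eq_self (fun x : ℝ => x ^ n * weight γ x) volume
  simp only [weight_neg, hn.neg_pow, neg_mul, integral_neg] at h
  unfold moment
  linarith

theorem moment_even {γ : ℝ} (hγ : -1 / 2 < γ) {n : ℕ} (hn : Even n) :
    moment γ n = Real.Gamma ((n + 2 * γ + 1) / 2) := by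
  have hs : (-1 : ℝ) < n + 2 * γ := by
    have : (0 : ℝ) ≤ n := n.cast_nonneg
    linarith
  have h1 : moment γ n = ∫ x : ℝ, (fun y => y ^ n * weight γ y) |x| :=
    integral_congr_ae (Filter.Eventually.of_forall fun x => by simp [hn.pow_abs, weight_abs])
  rw [h1, integral_comp_abs (f := fun y => y ^ n * weight γ y), setIntegral_congr_fun measurableSet_Ioi
    (fun x hx => pow_mul_weight γ n hx), integral_rpow_mul_exp_neg_mul_rpow two_pos hs one_pos,
    Real.one_rpow]
  ring

/-- The functional equation of `Γ`, which takes the place of integration by parts. -/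
theorem moment_succ_succ {γ : ℝ} (hγ : -1 / 2 < γ) {n : ℕ} (hn : Even n) :
    2 * moment γ (n + 2) = (n + 1 + 2 * γ) * moment γ n := by
  have hs : (0 : ℝ) < n + 2 * γ + 1 := by
    have : (0 : ℝ) ≤ n := n.cast_nonneg
    linarith
  rw [moment_even hγ hn, moment_even hγ (hn.add even_two)]
  have e : (((n + 2 : ℕ) : ℝ) + 2 * γ + 1) / 2 = (n + 2 * γ + 1) / 2 + 1 := by push_cast; ring
  rw [e, Real.Gamma_add_one (by positivity)]
  ring

/-- The functional integrating a polynomial against the product weight. -/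
def prodInt (N : ℕ) (γ : ℝ) : Poly N →ₗ[ℂ] ℂ :=
  (basisMonomials (Fin N) ℂ).constr ℂ fun m => ((∏ i, moment γ (m i) : ℝ) : ℂ)

theorem prodInt_monomial (γ : ℝ) (m : Fin N →₀ ℕ) (a : ℂ) :
    prodInt N γ (monomial m a) = a * ((∏ i, moment γ (m i) : ℝ) : ℂ) := by
  have h : (monomial m a : Poly N) = a • basisMonomials (Fin N) ℂ m := by
    rw [coe_basisMonomials, smul_monomial, smul_eq_mul, mul_one]
  rw [h, map_smul, prodInt, Module.Basis.constr_basis, smul_eq_mul]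

theorem eval_monomial_mul_weight (γ : ℝ) (m : Fin N →₀ ℕ) (a : ℂ) (z : Fin N → ℝ) :
    eval (fun i => (z i : ℂ)) (monomial m a) * ((∏ i, weight γ (z i) : ℝ) : ℂ)
      = a * ((∏ i, z i ^ m i * weight γ (z i) : ℝ) : ℂ) := by
  rw [eval_monomial, Finsupp.prod_fintype _ _ (by simp), Finset.prod_mul_distrib]
  push_cast
  ring

theorem integrable_eval_mul_weight {γ : ℝ} (hγ : -1 / 2 < γ) (f : Poly N) :
    Integrable fun z : Fin N → ℝ =>
      eval (fun i => (z i : ℂ)) f * ((∏ i, weight γ (z i) : ℝ) : ℂ) := by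
  induction f using MvPolynomial.induction_on' with
  | monomial m a =>
    simp only [eval_monomial_mul_weight]
    exact (Integrable.fintype_prod_dep
      (f := fun (i : Fin N) (x : ℝ) => x ^ m i * weight γ x)
      fun i => integrable_pow_mul_weight hγ (m i)).ofReal.const_mul a
  | add f g hf hg =>
    simp only [map_add, add_mul]
    exact hf.add hg

theorem integral_eval_mul_weight {γ : ℝ} (hγ : -1 / 2 < γ) (f : Poly N) :
    ∫ z : Fin N → ℝ, eval (fun i => (z i : ℂ)) f * ((∏ i, weight γ (z i) : ℝ) : ℂ)
      = prodInt N γ f := by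
  induction f using MvPolynomial.induction_on' with
  | monomial m a =>
    simp only [eval_monomial_mul_weight]
    rw [integral_const_mul, integral_complex_ofReal,
      integral_fintype_prod_volume_eq_prod (fun i (x : ℝ) => x ^ m i * weight γ x),
      prodInt_monomial]
    rfl
  | add f g hf hg =>
    simp only [map_add, add_mul]
    rw [integral_add (integrable_eval_mul_weight hγ f) (integrable_eval_mul_weight hγ g), hf, hg]

theorem prodInt_rename (γ : ℝ) (e : Equiv.Perm (Fin N)) (f : Poly N) :
    prodInt N γ (rename e f) = prodInt N γ f := by
  induction f using MvPolynomial.induction_on' with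
  | monomial m a =>
    rw [rename_monomial, prodInt_monomial, prodInt_monomial, ← Equiv.prod_comp e]
    simp [Finsupp.mapDomain_apply e.injective]
  | add f g hf hg => simp only [map_add, hf, hg]

theorem prodInt_exch (γ : ℝ) (j k : Fin N) (f : Poly N) :
    prodInt N γ (exch j k f) = prodInt N γ f :=
  prodInt_rename γ (Equiv.swap j k) f

theorem signChange_monomial (j : Fin N) (m : Fin N →₀ ℕ) (a : ℂ) :
    signChange j (monomial m a) = (-1 : ℂ) ^ m j • monomial m a := by
  have h (i : Fin N) : ((if i = j then -X i else X i : Poly N)) ^ m i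
      = (if i = j then C ((-1) ^ m i) else 1) * X i ^ m i := by
    split_ifs
    · rw [neg_pow, C_pow, C_neg, C_1]
    · rw [one_mul]
  rw [signChange, aeval_monomial, monomial_eq, Finsupp.prod_fintype _ _ (by simp),
    Finsupp.prod_fintype _ _ (by simp), Finset.prod_congr rfl fun i _ => h i,
    Finset.prod_mul_distrib, Finset.prod_ite_eq' Finset.univ j, if_pos (Finset.mem_univ j),
    smul_eq_C_mul, algebraMap_eq]
  ring

theorem prod_moment_eq_zero (γ : ℝ) {m : Fin N →₀ ℕ} {j : Fin N} (h : Odd (m j)) :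
    ∏ i, moment γ (m i) = 0 :=
  Finset.prod_eq_zero (Finset.mem_univ j) (moment_odd γ h)

theorem prodInt_signChange (γ : ℝ) (j : Fin N) (f : Poly N) :
    prodInt N γ (signChange j f) = prodInt N γ f := by
  induction f using MvPolynomial.induction_on' with
  | monomial m a =>
    rw [signChange_monomial, map_smul, prodInt_monomial]
    rcases Nat.even_or_odd (m j) with h | h
    · simp [h.neg_one_pow]
    · simp [prod_moment_eq_zero γ h]
  | add f g hf hg => simp only [map_add, hf, hg]

theorem prodInt_signedExch (γ : ℝ) (j k : Fin N) (f : Poly N) :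
    prodInt N γ (signedExch j k f) = prodInt N γ f := by
  rw [signedExch_apply, prodInt_signChange, prodInt_signChange, prodInt_exch]

/-- Integration by parts, checked on monomials. For an even exponent of `X j` both sides vanish by
parity. For an odd exponent `n + 1`, derivative and `ddT` contribute `n + 1` and `2 γ`, and the
moment recursion applies. -/
theorem prodInt_pderiv_add_ddT {γ : ℝ} (hγ : -1 / 2 < γ) (j : Fin N) (f : Poly N) :
    prodInt N γ (pderiv j f + (γ : ℂ) • ddT j f) = 2 * prodInt N γ (X j * f) := by
  induction f using MvPolynomial.induction_on' with
  | monomial m a =>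
    have hX : (X j * monomial m a : Poly N) = monomial (m + Finsupp.single j 1) a := by
      rw [X, monomial_mul, one_mul, add_comm]
    rw [hX]
    rcases Nat.even_or_odd (m j) with h | h
    · have h1 : ddT j (monomial m a) = 0 := by
        apply mul_left_cancel₀ (X_ne_zero j)
        rw [mul_ddT, signChange_monomial, h.neg_one_pow, one_smul, sub_self, mul_zero]
      have h2 : Odd ((m + Finsupp.single j 1 : Fin N →₀ ℕ) j) := by simpa using h.add_one
      rw [h1, smul_zero, add_zero, pderiv_monomial, prodInt_monomial, prodInt_monomial,
        prod_moment_eq_zero γ h2]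
      rcases Nat.eq_zero_or_pos (m j) with h0 | h0
      · simp [h0]
      · have h3 : Odd ((m - Finsupp.single j 1 : Fin N →₀ ℕ) j) := by
          simpa using Nat.Even.sub_odd h0 h odd_one
        rw [prod_moment_eq_zero γ h3]
        simp
    · have hp : 1 ≤ m j := h.pos
      obtain ⟨n, rfl⟩ : ∃ n, m = n + Finsupp.single j 1 :=
        ⟨m - Finsupp.single j 1, (tsub_add_cancel_of_le (by simpa using hp)).symm⟩
      have hn : Even (n j) := by
        have h' : Odd (n j + 1) := by simpa using h
        exact (Nat.odd_add_one.mp h') |> Nat.not_odd_iff_even.mp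
      have h1 : ddT j (monomial (n + Finsupp.single j 1) a) = (2 : ℂ) • monomial n a := by
        apply mul_left_cancel₀ (X_ne_zero j)
        rw [mul_ddT, signChange_monomial, h.neg_one_pow, mul_smul_comm, X, monomial_mul, one_mul,
          add_comm n]
        module
      rw [h1, pderiv_monomial, add_tsub_cancel_right, map_add, map_smul, map_smul,
        prodInt_monomial, prodInt_monomial, prodInt_monomial,
        ← Finset.mul_prod_erase _ _ (Finset.mem_univ j),
        ← Finset.mul_prod_erase Finset.univ
          (fun i => moment γ ((n + Finsupp.single j 1 + Finsupp.single j 1 : Fin N →₀ ℕ) i))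
          (Finset.mem_univ j)]
      have h2 : ∏ i ∈ Finset.univ.erase j,
            moment γ ((n + Finsupp.single j 1 + Finsupp.single j 1 : Fin N →₀ ℕ) i)
          = ∏ i ∈ Finset.univ.erase j, moment γ (n i) :=
        Finset.prod_congr rfl fun i hi => by
          simp [Finsupp.single_eq_of_ne (Finset.ne_of_mem_erase hi)]
      have h3 := congrArg (fun x : ℝ => (x : ℂ)) (moment_succ_succ hγ hn)
      rw [h2]
      simp only [Finsupp.add_apply, Finsupp.single_eq_same, smul_eq_mul]
      push_cast at h3 ⊢
      linear_combination (-a * ∏ i ∈ Finset.univ.erase j, (moment γ (n i) : ℂ)) * h3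
  | add f g hf hg =>
    rw [mul_add, map_add (prodInt N γ) (X j * f), mul_add, ← hf, ← hg, ← map_add]
    congr 1
    rw [map_add, map_add]
    module

/-! ### The discriminant factor -/

theorem derivation_prod {ι R A : Type*} [DecidableEq ι] [CommSemiring R] [CommSemiring A]
    [Algebra R A] (D : Derivation R A A) (s : Finset ι) (f : ι → A) :
    D (∏ i ∈ s, f i) = ∑ i ∈ s, (∏ k ∈ s.erase i, f k) * D (f i) := by
  induction s using Finset.induction_on with
  | empty => simp
  | insert a s ha ih =>
    rw [Finset.prod_insert ha, D.leibniz, ih, Finset.sum_insert ha, Finset.erase_insert ha,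
      smul_eq_mul, smul_eq_mul, Finset.mul_sum, add_comm]
    congr 1
    refine Finset.sum_congr rfl fun i hi => ?_
    have hia : a ≠ i := fun h => ha (h ▸ hi)
    rw [Finset.erase_insert_of_ne hia, Finset.prod_insert fun h => ha (Finset.mem_of_mem_erase h),
      mul_assoc]

/-- The product of all `X_j² - X_k²` with `j ≠ k`. -/
def disc (N : ℕ) : Poly N :=
  ∏ p ∈ (Finset.univ : Finset (Fin N)).offDiag, (X p.1 ^ 2 - X p.2 ^ 2)

/-- The discriminant without the factor `X_j² - X_k²`, and `0` for `j = k`. -/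
def discErase (j k : Fin N) : Poly N :=
  if j = k then 0 else
    ∏ p ∈ (Finset.univ : Finset (Fin N)).offDiag.erase (j, k), (X p.1 ^ 2 - X p.2 ^ 2)

@[simp] theorem discErase_self (j : Fin N) : discErase j j = 0 := by simp [discErase]

theorem X_sq_sub_X_sq_ne_zero {j k : Fin N} (h : k ≠ j) : (X j ^ 2 - X k ^ 2 : Poly N) ≠ 0 := by
  rw [sq_sub_sq]
  exact mul_ne_zero (X_add_X_ne_zero h) (X_sub_X_ne_zero h)

theorem disc_ne_zero : disc N ≠ 0 :=
  Finset.prod_ne_zero_iff.mpr fun _ hp => 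
    X_sq_sub_X_sq_ne_zero (Ne.symm (Finset.mem_offDiag.mp hp).2.2)

theorem mul_discErase {j k : Fin N} (h : k ≠ j) : (X j ^ 2 - X k ^ 2) * discErase j k = disc N := by
  have hm : (j, k) ∈ (Finset.univ : Finset (Fin N)).offDiag := by simp [h.symm]
  rw [discErase, if_neg h.symm, disc, ← Finset.mul_prod_erase _ _ hm]

theorem discErase_comm (j k : Fin N) : discErase k j = -discErase j k := by
  rcases eq_or_ne k j with rfl | h
  · simp
  apply mul_left_cancel₀ (X_sq_sub_X_sq_ne_zero h)
  rw [mul_neg, mul_discErase h, ← mul_discErase h.symm]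
  ring

theorem rename_disc (e : Equiv.Perm (Fin N)) : rename e (disc N) = disc N := by
  rw [disc, map_prod]
  refine Finset.prod_equiv (Equiv.prodCongr e e) (by simp) (fun p _ => by simp)

theorem exch_disc (j k : Fin N) : exch j k (disc N) = disc N := rename_disc _

theorem signChange_X_sq (j i : Fin N) : signChange j (X i ^ 2) = X i ^ 2 := by
  rw [map_pow, signChange_X]; split_ifs <;> ring

theorem signChange_disc (j : Fin N) : signChange j (disc N) = disc N := by
  simp only [disc, map_prod, map_sub, signChange_X_sq]

theorem exch_discErase (j k : Fin N) : exch j k (discErase j k) = -discErase j k := by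
  rcases eq_or_ne k j with rfl | h
  · simp
  have := congrArg (exch j k) (mul_discErase h)
  rw [exch_disc, ← mul_discErase h] at this
  simp at this
  apply mul_left_cancel₀ (X_sq_sub_X_sq_ne_zero h)
  linear_combination -this

theorem signChange_discErase (i j k : Fin N) : signChange i (discErase j k) = discErase j k := by
  rcases eq_or_ne k j with rfl | h
  · simp
  apply mul_left_cancel₀ (X_sq_sub_X_sq_ne_zero h)
  rw [mul_discErase h, ← signChange_disc i, ← mul_discErase h, map_mul, map_sub, signChange_X_sq,
    signChange_X_sq]

/-- The factor is 4 because both ordered pairs `(j, k)` and `(k, j)` contribute `2 X_j`. -/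
theorem pderiv_disc (j : Fin N) : pderiv j (disc N) = 4 * X j * ∑ k, discErase j k := by
  rw [disc, derivation_prod]
  have h1 : ∑ p ∈ (Finset.univ : Finset (Fin N)).offDiag,
        (∏ q ∈ (Finset.univ : Finset (Fin N)).offDiag.erase p, (X q.1 ^ 2 - X q.2 ^ 2 : Poly N))
          * pderiv j (X p.1 ^ 2 - X p.2 ^ 2)
      = ∑ p : Fin N × Fin N, discErase p.1 p.2 * pderiv j (X p.1 ^ 2 - X p.2 ^ 2) := by
    refine Finset.sum_subset_zero_on_sdiff (Finset.subset_univ _) ?_ ?_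
    · intro p hp
      have : p.1 = p.2 := by simpa using hp
      rw [this, discErase_self, zero_mul]
    · intro p hp
      rw [discErase, if_neg (by simpa using hp)]
  have h2 (a b : Fin N) : discErase a b * pderiv j (X a ^ 2 - X b ^ 2)
      = (if a = j then 2 * X a * discErase a b else 0)
        + (if b = j then 2 * X b * discErase b a else 0) := by
    rw [discErase_comm a b]
    simp only [map_sub, Derivation.leibniz_pow, pderiv_X, Pi.single_apply]
    split_ifs <;> simp <;> ring
  rw [h1, Fintype.sum_prod_type]
  simp only [h2, Finset.sum_add_distrib]
  rw [Finset.sum_comm (s := Finset.univ) (t := Finset.univ)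
    (f := fun a b => if b = j then 2 * X b * discErase b a else 0)]
  have h3 (a : Fin N) (F : Fin N → Poly N) :
      ∑ x, (if a = j then F x else 0) = if a = j then ∑ x, F x else 0 := by
    split_ifs <;> simp
  simp only [h3, Finset.sum_ite_eq', Finset.mem_univ, if_true, ← Finset.mul_sum]
  ring

/-! ### The scalar product as a functional -/

/-- The functional integrating a polynomial against the square of the ground state, up to sign. -/
def gInt (N β : ℕ) (γ : ℝ) : Poly N →ₗ[ℂ] ℂ :=
  (prodInt N γ).comp (LinearMap.mulRight ℂ (disc N ^ β))

theorem gInt_apply (β : ℕ) (γ : ℝ) (f : Poly N) :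
    gInt N β γ f = prodInt N γ (f * disc N ^ β) := rfl

theorem gInt_rename (β : ℕ) (γ : ℝ) (e : Equiv.Perm (Fin N)) (f : Poly N) :
    gInt N β γ (rename e f) = gInt N β γ f := by
  rw [gInt_apply, gInt_apply, ← prodInt_rename γ e (f * _), map_mul (rename e), map_pow (rename e),
    rename_disc]

theorem gInt_exch (β : ℕ) (γ : ℝ) (j k : Fin N) (f : Poly N) :
    gInt N β γ (exch j k f) = gInt N β γ f := gInt_rename β γ _ f

theorem gInt_signChange (β : ℕ) (γ : ℝ) (j : Fin N) (f : Poly N) :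
    gInt N β γ (signChange j f) = gInt N β γ f := by
  rw [gInt_apply, gInt_apply, ← prodInt_signChange γ j (f * _), map_mul (signChange j),
    map_pow (signChange j), signChange_disc]

theorem gInt_signedExch (β : ℕ) (γ : ℝ) (j k : Fin N) (f : Poly N) :
    gInt N β γ (signedExch j k f) = gInt N β γ f := by
  rw [signedExch_apply, gInt_signChange, gInt_signChange, gInt_exch]

/-- The function `β disc ^ β / (X_j² - X_k²)`. -/
def discLog (β : ℕ) (j k : Fin N) : Poly N := C (β : ℂ) * disc N ^ (β - 1) * discErase j k

theorem mul_discLog (β : ℕ) {j k : Fin N} (h : k ≠ j) :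
    (X j ^ 2 - X k ^ 2) * discLog β j k = C (β : ℂ) * disc N ^ β := by
  rw [discLog, mul_left_comm, mul_discErase h]
  cases β with
  -- For `β = 0` the exponent `β - 1` truncates to `0`, harmlessly, since the factor `C β` vanishes.
  | zero => simp
  | succ n => rw [Nat.add_sub_cancel, pow_succ, mul_assoc]

theorem pderiv_disc_pow (β : ℕ) (j : Fin N) :
    pderiv j (disc N ^ β) = 4 * X j * ∑ k, discLog β j k := by
  simp only [discLog, ← Finset.mul_sum, Derivation.leibniz_pow, pderiv_disc, smul_eq_mul,
    nsmul_eq_mul, map_natCast]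
  ring

theorem exch_discLog (β : ℕ) (j k : Fin N) : exch j k (discLog β j k) = -discLog β j k := by
  simp only [discLog, map_mul, map_pow, exch_disc, exch_discErase, map_natCast]
  ring

theorem signedExch_discLog (β : ℕ) (j k : Fin N) :
    signedExch j k (discLog β j k) = -discLog β j k := by
  rw [signedExch_apply, exch_discLog]
  simp only [discLog, map_neg, map_mul, map_pow, signChange_disc, signChange_discErase, map_natCast]

/-- Dividing `β disc ^ β` by `X_j - X_k` leaves `(X_j + X_k) * discLog β j k`, which is odd under
the exchange. Invariance of `prodInt` turns the term with `exch j k f` into a second copy of the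
term with `f`. -/
theorem gInt_ddA (β : ℕ) (γ : ℝ) (j k : Fin N) (f : Poly N) :
    gInt N β γ ((β : ℂ) • ddA j k f)
      = 2 * prodInt N γ ((X j + X k) * discLog β j k * f) := by
  rcases eq_or_ne k j with rfl | h
  · simp [discLog]
  have h1 : (β : ℂ) • ddA j k f * disc N ^ β
      = (X j + X k) * discLog β j k * f - (X j + X k) * discLog β j k * exch j k f := by
    rw [smul_eq_C_mul]
    linear_combination (-ddA j k f) * mul_discLog β h
      + (X j + X k) * discLog β j k * mul_ddA j k f
  have h2 := prodInt_exch γ j k ((X j + X k) * discLog β j k * f)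
  rw [map_mul (exch j k), map_mul (exch j k), exch_discLog, map_add, exch_X, exch_X, Equiv.swap_apply_left,
    Equiv.swap_apply_right, mul_neg, neg_mul, map_neg, add_comm (X k)] at h2
  rw [gInt_apply, h1, map_sub]
  linear_combination h2

theorem gInt_ddB (β : ℕ) (γ : ℝ) (j k : Fin N) (f : Poly N) :
    gInt N β γ ((β : ℂ) • ddB j k f)
      = 2 * prodInt N γ ((X j - X k) * discLog β j k * f) := by
  rcases eq_or_ne k j with rfl | h
  · simp [discLog]
  have h1 : (β : ℂ) • ddB j k f * disc N ^ β
      = (X j - X k) * discLog β j k * f - (X j - X k) * discLog β j k * signedExch j k f := by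
    rw [smul_eq_C_mul]
    linear_combination (-ddB j k f) * mul_discLog β h
      + (X j - X k) * discLog β j k * mul_ddB j k f
  have h2 := prodInt_signedExch γ j k ((X j - X k) * discLog β j k * f)
  have h3 : signedExch j k (X j - X k) = X j - X k := by
    simp [signedExch_apply, h, h.symm]; ring
  rw [map_mul (signedExch j k), map_mul (signedExch j k), signedExch_discLog, h3, mul_neg, neg_mul, map_neg] at h2
  rw [gInt_apply, h1, map_sub]
  linear_combination h2

theorem ddT_disc_pow (β : ℕ) (j : Fin N) : ddT j (disc N ^ β) = 0 := by
  apply mul_left_cancel₀ (X_ne_zero j)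
  rw [mul_ddT, map_pow, signChange_disc, sub_self, mul_zero]

/-- The divided differences integrate to `2 (X_j + X_k) + 2 (X_j - X_k) = 4 X_j` times `discLog β j
k`, which is exactly what the derivative of `disc ^ β` produces. -/
theorem gInt_dunklB {γ : ℝ} (hγ : -1 / 2 < γ) (β : ℕ) (j : Fin N) (f : Poly N) :
    gInt N β γ (dunklB β γ j f) = 2 * gInt N β γ (X j * f) := by
  have h1 := prodInt_pderiv_add_ddT hγ j (disc N ^ β * f)
  rw [ddT_mul, ddT_disc_pow, zero_mul, add_zero, Derivation.leibniz, pderiv_disc_pow, smul_eq_mul,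
    smul_eq_mul, map_add, map_add] at h1
  have h2 : ∑ k, gInt N β γ ((β : ℂ) • (ddA j k f + ddB j k f))
      = prodInt N γ (f * (4 * X j * ∑ k, discLog β j k)) := by
    rw [Finset.mul_sum, Finset.mul_sum, map_sum]
    refine Finset.sum_congr rfl fun k _ => ?_
    rw [smul_add, map_add, gInt_ddA, gInt_ddB, ← mul_add, ← map_add, ← smul_eq_mul 2, ← map_smul,
      smul_eq_C_mul, map_ofNat]
    congr 1
    ring
  rw [dunklB_apply, map_add, map_add, Finset.smul_sum, map_sum, h2, gInt_apply, gInt_apply,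
    gInt_apply, mul_comm (X j * f), mul_left_comm (disc N ^ β), ← h1, mul_comm (pderiv j f), smul_mul_assoc,
    mul_comm (ddT j f)]

/-! ### The adjoint of a Dunkl operator. -/

theorem exch_ddA (j k : Fin N) (f : Poly N) : exch j k (ddA j k f) = ddA j k f := by
  rcases eq_or_ne k j with rfl | h
  · simp
  have := congrArg (exch j k) (mul_ddA j k f)
  simp only [map_mul, map_sub, exch_X, Equiv.swap_apply_left, Equiv.swap_apply_right,
    exch_exch] at this
  apply mul_left_cancel₀ (X_sub_X_ne_zero h)
  rw [mul_ddA]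
  linear_combination -this

theorem signedExch_signedExch (j k : Fin N) (f : Poly N) :
    signedExch j k (signedExch j k f) = f := by
  rw [signedExch_apply j k f, signedExch_apply, exch_signChange_left, exch_signChange_right,
    exch_exch, signChange_signChange, signChange_signChange]

theorem signedExch_X_add_X {j k : Fin N} (h : k ≠ j) :
    signedExch j k (X j + X k) = -(X j + X k) := by
  simp [signedExch_apply, h, h.symm]

theorem signedExch_ddB (j k : Fin N) (f : Poly N) : signedExch j k (ddB j k f) = ddB j k f := by
  rcases eq_or_ne k j with rfl | h
  · simp
  have := congrArg (signedExch j k) (mul_ddB j k f)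
  rw [map_mul, signedExch_X_add_X h, map_sub, signedExch_signedExch] at this
  apply mul_left_cancel₀ (X_add_X_ne_zero h)
  rw [mul_ddB]
  linear_combination -this

theorem signChange_ddT_self (j : Fin N) (f : Poly N) : signChange j (ddT j f) = ddT j f := by
  have := congrArg (signChange j) (mul_ddT j f)
  rw [map_mul, signChange_X, if_pos rfl, map_sub, signChange_signChange] at this
  apply mul_left_cancel₀ (X_ne_zero j)
  rw [mul_ddT]
  linear_combination -this

/-- The divided differences are invariant under the reflection and the linear factor changes sign,
so the integrand is odd. The same holds for the next two lemmas. -/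
theorem gInt_correction_ddA (β : ℕ) (γ : ℝ) (j k : Fin N) (f g : Poly N) :
    gInt N β γ ((X j - X k) * (ddA j k f * ddA j k g)) = 0 := by
  have h := gInt_exch β γ j k ((X j - X k) * (ddA j k f * ddA j k g))
  rw [map_mul (exch j k), map_mul (exch j k), exch_ddA, exch_ddA, map_sub, exch_X, exch_X, Equiv.swap_apply_left,
    Equiv.swap_apply_right, ← neg_sub, neg_mul, map_neg] at h
  linear_combination (-1 / 2 : ℂ) * h

theorem gInt_correction_ddB (β : ℕ) (γ : ℝ) (j k : Fin N) (f g : Poly N) :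
    gInt N β γ ((X j + X k) * (ddB j k f * ddB j k g)) = 0 := by
  rcases eq_or_ne k j with rfl | hk
  · simp
  have h := gInt_signedExch β γ j k ((X j + X k) * (ddB j k f * ddB j k g))
  rw [map_mul (signedExch j k), map_mul (signedExch j k), signedExch_ddB, signedExch_ddB, signedExch_X_add_X hk, neg_mul,
    map_neg] at h
  linear_combination (-1 / 2 : ℂ) * h

theorem gInt_correction_ddT (β : ℕ) (γ : ℝ) (j : Fin N) (f g : Poly N) :
    gInt N β γ (X j * (ddT j f * ddT j g)) = 0 := by
  have h := gInt_signChange β γ j (X j * (ddT j f * ddT j g))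
  rw [map_mul (signChange j), map_mul (signChange j), signChange_ddT_self, signChange_ddT_self, signChange_X, if_pos rfl, neg_mul,
    map_neg] at h
  linear_combination (-1 / 2 : ℂ) * h

/-- The defect in the Leibniz rule is written as a sum of terms each odd under one reflection, so
that it integrates to zero. -/
theorem dunklB_mul (β : ℕ) (γ : ℝ) (j : Fin N) (f g : Poly N) :
    dunklB β γ j (f * g) = dunklB β γ j f * g + f * dunklB β γ j g
      - (β : ℂ) • ∑ k, ((X j - X k) * (ddA j k f * ddA j k g)
        + (X j + X k) * (ddB j k f * ddB j k g))
      - (γ : ℂ) • (X j * (ddT j f * ddT j g)) := by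
  have hs : ∑ k, (ddA j k (f * g) + ddB j k (f * g))
      = (∑ k, (ddA j k f + ddB j k f)) * g + f * ∑ k, (ddA j k g + ddB j k g)
        - ∑ k, ((X j - X k) * (ddA j k f * ddA j k g)
          + (X j + X k) * (ddB j k f * ddB j k g)) := by
    rw [Finset.sum_mul, Finset.mul_sum, ← Finset.sum_add_distrib, ← Finset.sum_sub_distrib]
    refine Finset.sum_congr rfl fun k _ => ?_
    rw [ddA_mul, ddB_mul]
    linear_combination ddA j k f * mul_ddA j k g + ddB j k f * mul_ddB j k g
  have ht : ddT j (f * g) = ddT j f * g + f * ddT j g - X j * (ddT j f * ddT j g) := by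
    rw [ddT_mul]
    linear_combination ddT j f * mul_ddT j g
  rw [dunklB_apply, dunklB_apply, dunklB_apply, hs, ht, Derivation.leibniz]
  simp only [smul_eq_C_mul, smul_eq_mul]
  ring

theorem gInt_dunklB_mul {γ : ℝ} (hγ : -1 / 2 < γ) (β : ℕ) (j : Fin N) (f g : Poly N) :
    gInt N β γ (dunklB β γ j f * g) = 2 * gInt N β γ (f * raising β γ j g) := by
  have h1 := gInt_dunklB hγ β j (f * g)
  rw [dunklB_mul] at h1
  simp only [map_sub, map_add, map_smul, map_sum, gInt_correction_ddA, gInt_correction_ddB,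
    gInt_correction_ddT, add_zero, Finset.sum_const_zero, smul_zero, sub_zero] at h1
  rw [raising_apply, mul_sub, map_sub, mul_smul_comm, map_smul, smul_eq_mul, mul_left_comm f]
  linear_combination h1

/-! ### The scalar product -/

/-- The sign of the discriminant relative to a square of real numbers, raised to the power `β`. -/
def discSign (N β : ℕ) : ℝ := (∏ i : Fin N, ∏ _j ∈ Finset.Ioi i, (-1 : ℝ)) ^ β

theorem discSign_ne_zero (β : ℕ) : discSign N β ≠ 0 := by
  refine pow_ne_zero _ ?_
  simp [Finset.prod_ne_zero_iff]

/-- The product over ordered pairs is the product over `j < k` of `-(z_j² - z_k²)²`; the signs are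
collected in `discSign`. -/
theorem groundState_sq (β : ℕ) (γ : ℝ) (z : Fin N → ℝ) :
    groundState β γ z ^ 2 = discSign N β *
      (∏ p ∈ (Finset.univ : Finset (Fin N)).offDiag, (z p.1 ^ 2 - z p.2 ^ 2)) ^ β *
      ∏ i, weight γ (z i) := by
  have h1 : ∏ p ∈ (Finset.univ : Finset (Fin N)).offDiag, (z p.1 ^ 2 - z p.2 ^ 2)
      = ∏ i, ∏ j ∈ {i}ᶜ, (z i ^ 2 - z j ^ 2) :=
    Finset.prod_finset_product _ _ _ (by simp [eq_comm])
  rw [h1, ← Finset.prod_prod_Ioi_mul_eq_prod_prod_off_diag fun j i => z i ^ 2 - z j ^ 2, discSign,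
    ← mul_pow, ← Finset.prod_mul_distrib, groundState, mul_pow, ← Finset.prod_pow (n := 2)
      (f := fun j => |z j| ^ γ * Real.exp (-z j ^ 2 / 2))]
  refine congrArg (· * _) ?_
  simp only [← Finset.prod_pow, ← Finset.prod_mul_distrib]
  refine Finset.prod_congr rfl fun i _ => Finset.prod_congr rfl fun j _ => ?_
  rw [← pow_mul, mul_comm β 2, pow_mul, sq_abs]
  ring

theorem integrandB_eq (β : ℕ) (γ : ℝ) (f g : Poly N) (z : Fin N → ℝ) :
    integrandB β γ f g z = (discSign N β : ℂ) * (eval (fun i => (z i : ℂ)) (f * g * disc N ^ β) *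
      ((∏ i, weight γ (z i) : ℝ) : ℂ)) := by
  rw [integrandB, groundState_sq, disc]
  simp only [map_mul, map_pow, map_prod, map_sub, eval_X]
  push_cast
  ring

theorem integrable_integrandB {γ : ℝ} (hγ : -1 / 2 < γ) (β : ℕ) (f g : Poly N) :
    Integrable (integrandB β γ f g) := by
  rw [funext (integrandB_eq β γ f g)]
  exact (integrable_eval_mul_weight hγ _).const_mul _

theorem scalarB_eq {γ : ℝ} (hγ : -1 / 2 < γ) (β : ℕ) (f g : Poly N) :
    scalarB β γ f g = discSign N β * gInt N β γ (f * g) := by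
  rw [scalarB, funext (integrandB_eq β γ f g), integral_const_mul, integral_eval_mul_weight hγ]
  rfl

theorem scalarB_eq_zero_iff {γ : ℝ} (hγ : -1 / 2 < γ) (β : ℕ) (f g : Poly N) :
    scalarB β γ f g = 0 ↔ gInt N β γ (f * g) = 0 := by
  rw [scalarB_eq hγ, mul_eq_zero, or_iff_right]
  exact_mod_cast discSign_ne_zero β

/-! ### Nondegeneracy of the scalar product. -/

theorem eval_ofReal_map_conj (f : Poly N) (z : Fin N → ℝ) :
    eval (fun i => (z i : ℂ)) (map (starRingEnd ℂ) f)
      = starRingEnd ℂ (eval (fun i => (z i : ℂ)) f) := by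
  induction f using MvPolynomial.induction_on with
  | C a => simp
  | add f g hf hg => simp only [map_add, hf, hg]
  | mul_X f i hf => simp only [map_mul, hf, map_X, eval_X, Complex.conj_ofReal]

theorem eq_zero_of_ae_eval_eq_zero (f : Poly N)
    (h : ∀ᵐ z : Fin N → ℝ, eval (fun i => (z i : ℂ)) f = 0) : f = 0 := by
  have hc : Continuous fun z : Fin N → ℝ => eval (fun i => (z i : ℂ)) f :=
    (MvPolynomial.continuous_eval f).comp (by fun_prop)
  have h0 := (Continuous.ae_eq_iff_eq volume hc continuous_const).mp h
  refine funext_set (fun _ => Set.range ((↑) : ℝ → ℂ))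
    (fun _ => Set.infinite_range_of_injective Complex.ofReal_injective) fun x hx => ?_
  choose z hz using fun i => hx i trivial
  rw [← funext hz, map_zero]
  exact congrFun h0 z

/-- The form is bilinear over `ℂ`, so positivity appears on pairing `f` with its coefficientwise
conjugate: at real points the integrand is `|f|²` times the weight. -/
theorem eq_zero_of_scalarB_conj_eq_zero {γ : ℝ} (hγ : -1 / 2 < γ) (β : ℕ) (f : Poly N)
    (h : scalarB β γ f (map (starRingEnd ℂ) f) = 0) : f = 0 := by
  have e (z : Fin N → ℝ) : integrandB β γ f (map (starRingEnd ℂ) f) z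
      = ((Complex.normSq (eval (fun i => (z i : ℂ)) f) * groundState β γ z ^ 2 : ℝ) : ℂ) := by
    rw [integrandB, eval_ofReal_map_conj, Complex.mul_conj]
    push_cast
    ring
  have hi := integrable_integrandB hγ β f (map (starRingEnd ℂ) f)
  rw [scalarB, funext e, integral_complex_ofReal, Complex.ofReal_eq_zero,
    integral_eq_zero_iff_of_nonneg (fun z => mul_nonneg (Complex.normSq_nonneg _) (sq_nonneg _))]
    at h
  -- The weight is known to be nonzero only off the hyperplanes cut out by `disc` and the
  -- coordinates; these factors are cancelled afterwards.
  · have hz : f * disc N * ∏ i, X i = 0 := by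
      apply eq_zero_of_ae_eval_eq_zero
      filter_upwards [h] with z hz
      have hz' := e z
      rw [show Complex.normSq (eval (fun i => (z i : ℂ)) f) * groundState β γ z ^ 2 = 0 from hz,
        integrandB_eq, eval_mul, eval_mul, eval_ofReal_map_conj, map_pow] at hz'
      by_contra hne
      simp only [map_mul, map_prod, eval_X, mul_ne_zero_iff, Finset.prod_ne_zero_iff] at hne
      obtain ⟨⟨h1, h2⟩, h3⟩ := hne
      refine absurd hz' ?_
      rw [Complex.ofReal_zero]
      refine mul_ne_zero (by exact_mod_cast discSign_ne_zero β) (mul_ne_zero (mul_ne_zero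
        (mul_ne_zero h1 ((map_ne_zero _).mpr h1)) (pow_ne_zero _ h2)) ?_)
      rw [Complex.ofReal_ne_zero, Finset.prod_ne_zero_iff]
      exact fun i hi => (weight_pos γ (by simpa using h3 i hi)).ne'
    have hX : (∏ i, X i : Poly N) ≠ 0 := Finset.prod_ne_zero_iff.mpr fun i _ => X_ne_zero i
    exact (mul_eq_zero.mp ((mul_eq_zero.mp hz).resolve_right hX)).resolve_right disc_ne_zero
  · rw [funext e] at hi
    exact hi.re

/-! ### Dunkl operators of type `A` and even polynomials -/

theorem dunklA_apply (β : ℕ) (j : Fin N) (f : Poly N) :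
    dunklA β j f = pderiv j f + (β : ℂ) • ∑ k, ddA j k f := by
  have h : dunklA β j = del j + (β : ℂ) • ∑ k, ddA j k := by
    rw [← sum_subtype_ne j _ (by simp), dunklA]
    congr 3
    ext1 k
    rw [ddA, dif_pos k.2]
  simp [h, del, LinearMap.sum_apply]

/-- The operator `X_j D^A_j`. -/
def eulerA (β : ℕ) (j : Fin N) : Module.End ℂ (Poly N) := mulVar j * dunklA β j

theorem eulerA_apply (β : ℕ) (j : Fin N) (f : Poly N) :
    eulerA β j f = X j * dunklA β j f := rfl

theorem cherednikA_apply (β : ℕ) (j : Fin N) (f : Poly N) :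
    cherednikA β j f = eulerA β j f + (β : ℂ) • ∑ k ∈ Finset.Iio j, exch j k f := by
  simp [cherednikA, eulerA, LinearMap.sum_apply]

theorem rename_dunklA (β : ℕ) (e : Equiv.Perm (Fin N)) (j : Fin N) (f : Poly N) :
    rename e (dunklA β j f) = dunklA β (e j) (rename e f) := by
  rw [dunklA_apply, dunklA_apply, map_add, map_smul, map_sum, pderiv_rename e.injective,
    ← Equiv.sum_comp e fun k => ddA (e j) k (rename e f)]
  simp only [rename_ddA]

theorem rename_eulerA (β : ℕ) (e : Equiv.Perm (Fin N)) (j : Fin N) (f : Poly N) :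
    rename e (eulerA β j f) = eulerA β (e j) (rename e f) := by
  rw [eulerA_apply, eulerA_apply, map_mul, rename_X, rename_dunklA]

theorem exch_expand (j k : Fin N) (f : Poly N) : exch j k (expand 2 f) = expand 2 (exch j k f) :=
  rename_expand _ _ f

theorem signChange_expand (j : Fin N) (f : Poly N) : signChange j (expand 2 f) = expand 2 f := by
  have : (signChange j).comp (expand 2) = (expand 2 : Poly N →ₐ[ℂ] Poly N) := by
    apply algHom_ext; intro i
    simp only [AlgHom.comp_apply, expand_X, signChange_X_sq]
  exact DFunLike.congr_fun this f

theorem signedExch_expand (j k : Fin N) (f : Poly N) :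
    signedExch j k (expand 2 f) = expand 2 (exch j k f) := by
  rw [signedExch_apply, exch_expand, signChange_expand, signChange_expand]

theorem pderiv_expand_two (j : Fin N) (f : Poly N) :
    pderiv j (expand 2 f) = 2 * X j * expand 2 (pderiv j f) := by
  induction f using MvPolynomial.induction_on with
  | C a => simp
  | add f g hf hg => simp only [map_add, hf, hg, mul_add]
  | mul_X f k hf =>
    simp only [map_mul, Derivation.leibniz, smul_eq_mul, map_add, hf, expand_X, pderiv_X,
      Derivation.leibniz_pow]
    rcases eq_or_ne k j with rfl | h
    · simp; ring
    · simp [h]; ring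

/-- Both reflections act alike on functions of the squares, and `1 / (z_j - z_k) + 1 / (z_j + z_k) =
2 z_j / (z_j² - z_k²)`. -/
theorem ddA_add_ddB_expand (j k : Fin N) (f : Poly N) :
    ddA j k (expand 2 f) + ddB j k (expand 2 f) = 2 * X j * expand 2 (ddA j k f) := by
  rcases eq_or_ne k j with rfl | h
  · simp
  apply mul_left_cancel₀ (X_sq_sub_X_sq_ne_zero h)
  have h1 := mul_ddA j k (expand 2 f)
  have h2 := mul_ddB j k (expand 2 f)
  have h3 := congrArg (expand 2) (mul_ddA j k f)
  rw [exch_expand] at h1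
  rw [signedExch_expand] at h2
  simp only [map_mul, map_sub, expand_X] at h3
  linear_combination (X j + X k) * h1 + (X j - X k) * h2 - 2 * X j * h3

theorem ddT_expand (j : Fin N) (f : Poly N) : ddT j (expand 2 f) = 0 := by
  apply mul_left_cancel₀ (X_ne_zero j)
  rw [mul_ddT, signChange_expand, sub_self, mul_zero]

theorem dunklB_expand (β : ℕ) (γ : ℝ) (j : Fin N) (f : Poly N) :
    dunklB β γ j (expand 2 f) = 2 * X j * expand 2 (dunklA β j f) := by
  rw [dunklB_apply, dunklA_apply]
  simp only [ddA_add_ddB_expand, ddT_expand, pderiv_expand_two, map_add, map_smul, map_sum,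
    ← Finset.mul_sum, mul_add, mul_smul_comm, smul_zero, add_zero]

theorem X_mul_dunklB_expand (β : ℕ) (γ : ℝ) (j : Fin N) (f : Poly N) :
    X j * dunklB β γ j (expand 2 f) = (2 : ℂ) • expand 2 (eulerA β j f) := by
  rw [dunklB_expand, eulerA_apply, map_mul, expand_X, smul_eq_C_mul, map_ofNat]
  ring

/-- The type `B` Dunkl Laplacian in the variables `X_j²`. -/
def laplaceA (β : ℕ) (γ : ℝ) (f : Poly N) : Poly N :=
  ∑ j, ((4 : ℂ) • eulerA β j (dunklA β j f) + (2 + 4 * γ : ℂ) • dunklA β j f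
    + (4 * β : ℂ) • ∑ l ∈ Finset.univ.erase j, exch j l (dunklA β j f))

/-- After one `D_j` the polynomial is `2 z_j` times an even one; the commutator of the second `D_j`
with `z_j` brings in `γ` and the exchanges. -/
theorem dunklLaplace_expand (β : ℕ) (γ : ℝ) (f : Poly N) :
    dunklLaplace N β γ (expand 2 f) = expand 2 (laplaceA β γ f) := by
  rw [dunklLaplace_apply, laplaceA, map_sum]
  refine Finset.sum_congr rfl fun j _ => ?_
  have h : (2 * X j * expand 2 (dunklA β j f) : Poly N)
      = (2 : ℂ) • (X j * expand 2 (dunklA β j f)) := by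
    rw [smul_eq_C_mul, map_ofNat, mul_assoc]
  rw [dunklB_expand, h, map_smul, dunklB_X_mul, X_mul_dunklB_expand, comDX, if_pos rfl,
    signChange_expand]
  simp only [exch_expand, signedExch_expand, map_add, map_smul, map_sum, Finset.sum_add_distrib]
  module

/-! ### Self-adjointness -/

/-- The scalar product of the transforms of two even polynomials, up to sign. -/
def evenForm (β : ℕ) (γ : ℝ) (f g : Poly N) : ℂ :=
  gInt N β γ (gaussT N β γ (expand 2 f) * gaussT N β γ (expand 2 g))

theorem scalarB_sigmaB_eq_zero_iff {γ : ℝ} (hγ : -1 / 2 < γ) (β : ℕ) (f g : Poly N) :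
    scalarB β γ (sigmaB β γ f) (sigmaB β γ g) = 0 ↔ evenForm β γ f g = 0 := by
  rw [scalarB_eq_zero_iff hγ, sigmaB_eq_gaussT, sigmaB_eq_gaussT, evenForm]

theorem evenForm_smul_left (β : ℕ) (γ : ℝ) (c : ℂ) (f g : Poly N) :
    evenForm β γ (c • f) g = c * evenForm β γ f g := by
  simp only [evenForm, map_smul, smul_mul_assoc, smul_eq_mul]

theorem evenForm_smul_right (β : ℕ) (γ : ℝ) (c : ℂ) (f g : Poly N) :
    evenForm β γ f (c • g) = c * evenForm β γ f g := by
  simp only [evenForm, map_smul, mul_smul_comm, smul_eq_mul]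

/-- Self-adjointness with respect to `evenForm`. -/
def IsEvenAdjoint (β : ℕ) (γ : ℝ) (T : Module.End ℂ (Poly N)) : Prop :=
  ∀ f g, evenForm β γ (T f) g = evenForm β γ f (T g)

theorem IsEvenAdjoint.add {β : ℕ} {γ : ℝ} {S T : Module.End ℂ (Poly N)}
    (hS : IsEvenAdjoint β γ S) (hT : IsEvenAdjoint β γ T) : IsEvenAdjoint β γ (S + T) := by
  intro f g
  have h1 := hS f g
  have h2 := hT f g
  simp only [evenForm, LinearMap.add_apply, map_add, add_mul, mul_add] at h1 h2 ⊢
  rw [h1, h2]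

theorem IsEvenAdjoint.sub {β : ℕ} {γ : ℝ} {S T : Module.End ℂ (Poly N)}
    (hS : IsEvenAdjoint β γ S) (hT : IsEvenAdjoint β γ T) : IsEvenAdjoint β γ (S - T) := by
  intro f g
  have h1 := hS f g
  have h2 := hT f g
  simp only [evenForm, LinearMap.sub_apply, map_sub, sub_mul, mul_sub] at h1 h2 ⊢
  rw [h1, h2]

theorem IsEvenAdjoint.smul {β : ℕ} {γ : ℝ} {T : Module.End ℂ (Poly N)} (c : ℂ)
    (hT : IsEvenAdjoint β γ T) : IsEvenAdjoint β γ (c • T) := by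
  intro f g
  rw [LinearMap.smul_apply, LinearMap.smul_apply, evenForm_smul_left, evenForm_smul_right, hT f g]

theorem isEvenAdjoint_one {β : ℕ} {γ : ℝ} :
    IsEvenAdjoint β γ (1 : Module.End ℂ (Poly N)) := fun _ _ => rfl

theorem IsEvenAdjoint.sum {β : ℕ} {γ : ℝ} {ι : Type*} (s : Finset ι)
    {T : ι → Module.End ℂ (Poly N)} (hT : ∀ i ∈ s, IsEvenAdjoint β γ (T i)) :
    IsEvenAdjoint β γ (∑ i ∈ s, T i) :=
  Finset.sum_induction T (IsEvenAdjoint β γ) (fun _ _ => IsEvenAdjoint.add)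
    (fun f g => by simp [evenForm]) hT

theorem IsEvenAdjoint.sq {β : ℕ} {γ : ℝ} {T : Module.End ℂ (Poly N)}
    (hT : IsEvenAdjoint β γ T) : IsEvenAdjoint β γ (T ^ 2) := by
  intro f g
  rw [pow_two, Module.End.mul_apply, Module.End.mul_apply, hT, hT]

/-- `gaussT` turns `X_j` into `raising`, half the adjoint of `D_j`, and commutes with `D_j`. -/
theorem gInt_gaussT_X_mul {γ : ℝ} (hγ : -1 / 2 < γ) (β : ℕ) (j : Fin N) (f g : Poly N) :
    2 * gInt N β γ (gaussT N β γ (X j * f) * gaussT N β γ g)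
      = gInt N β γ (gaussT N β γ f * gaussT N β γ (dunklB β γ j g)) := by
  rw [gaussT_X_mul, ← dunklB_gaussT, mul_comm (raising β γ j _), ← gInt_dunklB_mul hγ, mul_comm]

/-- With `F`, `H` the even polynomials, `2 ⟨G X_j D_j F, G H⟩ = ⟨G D_j F, G D_j H⟩` is symmetric in
`F` and `H`. -/
theorem isEvenAdjoint_eulerA {γ : ℝ} (hγ : -1 / 2 < γ) (β : ℕ) (j : Fin N) :
    IsEvenAdjoint β γ (eulerA β j) := by
  intro f g
  have h1 := gInt_gaussT_X_mul hγ β j (dunklB β γ j (expand 2 f)) (expand 2 g)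
  have h2 := gInt_gaussT_X_mul hγ β j (dunklB β γ j (expand 2 g)) (expand 2 f)
  rw [X_mul_dunklB_expand, map_smul, smul_mul_assoc, map_smul, smul_eq_mul] at h1 h2
  rw [mul_comm (gaussT N β γ (dunklB β γ j (expand 2 g))), ← h1,
    mul_comm (gaussT N β γ (expand 2 (eulerA β j g)))] at h2
  unfold evenForm
  linear_combination (-1 / 4 : ℂ) * h2

theorem isEvenAdjoint_exch (β : ℕ) (γ : ℝ) (j k : Fin N) :
    IsEvenAdjoint β γ (exch j k).toLinearMap := by
  intro f g
  rw [AlgHom.toLinearMap_apply, AlgHom.toLinearMap_apply, evenForm, evenForm,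
    ← gInt_exch β γ j k (gaussT N β γ (expand 2 (exch j k f)) * _), map_mul (exch j k),
    exch_gaussT, exch_gaussT, exch_expand, exch_expand, exch_exch]

theorem isEvenAdjoint_sutherland {γ : ℝ} (hγ : -1 / 2 < γ) (β : ℕ) :
    IsEvenAdjoint β γ (sutherland N β) := by
  refine IsEvenAdjoint.sum _ fun j _ => IsEvenAdjoint.sq ?_
  exact ((isEvenAdjoint_eulerA hγ β j).add ((IsEvenAdjoint.sum _ fun k _ =>
    isEvenAdjoint_exch β γ j k).smul _)).sub (isEvenAdjoint_one.smul _)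

theorem IsEvenAdjoint.evenForm_eq_zero {β : ℕ} {γ : ℝ} {T : Module.End ℂ (Poly N)}
    (hT : IsEvenAdjoint β γ T) {f g : Poly N} {a b : ℂ} (hf : T f = a • f) (hg : T g = b • g)
    (hab : a ≠ b) : evenForm β γ f g = 0 := by
  have h := hT f g
  rw [hf, hg, evenForm_smul_left, evenForm_smul_right] at h
  exact (mul_eq_zero.mp (show (a - b) * evenForm β γ f g = 0 by linear_combination h)).resolve_left
    (sub_ne_zero.mpr hab)

/-! ### Action on symmetric polynomials -/

theorem exch_of_isSymmetric {f : Poly N} (hf : f.IsSymmetric) (j k : Fin N) : exch j k f = f :=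
  hf _

theorem dunklA_of_isSymmetric (β : ℕ) {f : Poly N} (hf : f.IsSymmetric) (j : Fin N) :
    dunklA β j f = pderiv j f := by
  have h (k : Fin N) : ddA j k f = 0 := by
    rcases eq_or_ne k j with rfl | h
    · simp
    apply mul_left_cancel₀ (X_sub_X_ne_zero h)
    rw [mul_ddA, exch_of_isSymmetric hf, sub_self, mul_zero]
  simp [dunklA_apply, h]

theorem sum_eulerA_of_isSymmetric (β : ℕ) {f : Poly N} (hf : f.IsSymmetric) {n : ℕ}
    (hn : f.IsHomogeneous n) : (∑ j, eulerA β j) f = (n : ℂ) • f := by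
  rw [LinearMap.sum_apply]
  simp only [eulerA_apply, dunklA_of_isSymmetric β hf]
  rw [hn.sum_X_mul_pderiv, Nat.cast_smul_eq_nsmul]

theorem exch_eulerA_of_isSymmetric (β : ℕ) {f : Poly N} (hf : f.IsSymmetric) (j k : Fin N) :
    exch j k (eulerA β j f) = eulerA β k f := by
  have h := rename_eulerA β (Equiv.swap j k) j f
  rwa [Equiv.swap_apply_left, hf] at h

/-- The constant by which the Sutherland operator differs from `∑_j (X_j D^A_j)²`. -/
def sutherlandShift (N β : ℕ) : ℂ :=
  ∑ j : Fin N, ((β : ℂ) * (j : ℕ) - (β : ℂ) / 2 * ((N : ℂ) - 1)) ^ 2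

/-- The shift `β (N - 1) / 2` makes the linear terms cancel: the total coefficient of `eulerA β k f`
is `β (N - 1 - k) + β k - β (N - 1) = 0`. What remains is manifestly permutation invariant. -/
theorem sutherland_of_isSymmetric (β : ℕ) {f : Poly N} (hf : f.IsSymmetric) :
    sutherland N β f = ∑ j, eulerA β j (eulerA β j f) + sutherlandShift N β • f := by
  have h1 (j : Fin N) : cherednikA β j f = eulerA β j f + ((β : ℂ) * (j : ℕ)) • f := by
    rw [cherednikA_apply]
    simp only [exch_of_isSymmetric hf, Finset.sum_const, Fin.card_Iio]
    module
  have h2 (j : Fin N) : cherednikA β j (eulerA β j f)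
      = eulerA β j (eulerA β j f) + (β : ℂ) • ∑ k ∈ Finset.Iio j, eulerA β k f := by
    rw [cherednikA_apply]
    simp only [exch_eulerA_of_isSymmetric β hf]
  have h3 : ∑ j : Fin N, ∑ k ∈ Finset.Iio j, eulerA β k f
      = ∑ k : Fin N, ((N : ℂ) - 1 - (k : ℕ)) • eulerA β k f := by
    rw [Finset.sum_comm' (t' := Finset.univ) (s' := fun k => Finset.Ioi k) (by simp)]
    refine Finset.sum_congr rfl fun k _ => ?_
    rw [Finset.sum_const, Fin.card_Ioi, ← Nat.cast_smul_eq_nsmul ℂ, Nat.sub_sub,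
      Nat.cast_sub (by omega)]
    push_cast
    congr 1
    ring
  set c : ℂ := (β : ℂ) / 2 * ((N : ℂ) - 1) with hc
  have h4 (j : Fin N) : ((cherednikA β j - c • 1) ^ 2 : Module.End ℂ (Poly N)) f
      = eulerA β j (eulerA β j f) + (β : ℂ) • ∑ k ∈ Finset.Iio j, eulerA β k f
        + ((β : ℂ) * (j : ℕ) - 2 * c) • eulerA β j f + ((β : ℂ) * (j : ℕ) - c) ^ 2 • f := by
    simp only [pow_two, Module.End.mul_apply, LinearMap.sub_apply, LinearMap.smul_apply,
      Module.End.one_apply, map_sub, map_add, map_smul, h1, h2]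
    module
  rw [sutherland, LinearMap.sum_apply, Finset.sum_congr rfl fun j _ => h4 j,
    Finset.sum_add_distrib, Finset.sum_add_distrib, Finset.sum_add_distrib, ← Finset.smul_sum, h3,
    ← Finset.sum_smul, sutherlandShift, add_left_inj, add_assoc, add_eq_left, Finset.smul_sum,
    ← Finset.sum_add_distrib]
  refine Finset.sum_eq_zero fun j _ => ?_
  rw [smul_smul, ← add_smul, hc]
  convert zero_smul ℂ _
  ring

/-! ### Dominance -/

/-- The sum of the first `n` parts. -/
def topSum (lam : Fin N → ℕ) (n : ℕ) : ℕ := ∑ i ∈ Finset.univ.filter (fun i : Fin N => (i : ℕ) < n), lam i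

theorem topSum_succ (lam : Fin N → ℕ) (k : Fin N) :
    topSum lam ((k : ℕ) + 1) = ∑ i ∈ Finset.Iic k, lam i := by
  have h : Finset.univ.filter (fun i : Fin N => (i : ℕ) < (k : ℕ) + 1) = Finset.Iic k := by
    ext i
    rw [Finset.mem_filter, Finset.mem_Iic, Fin.le_def, Nat.lt_succ_iff]
    exact and_iff_right (Finset.mem_univ i)
  rw [topSum, h]

theorem card_filter_val_lt {n : ℕ} (hn : n ≤ N) :
    (Finset.univ.filter fun i : Fin N => (i : ℕ) < n).card = n := by
  rw [Fin.card_filter_val_lt, min_eq_right hn]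

theorem sum_le_topSum {μ : Fin N → ℕ} (hμ : Antitone μ) (S : Finset (Fin N)) :
    ∑ i ∈ S, μ i ≤ topSum μ S.card := by
  rcases Nat.eq_zero_or_pos S.card with h0 | h0
  · rw [Finset.card_eq_zero.mp h0]; simp
  have hN : S.card ≤ N := by simpa using S.card_le_univ
  set A := Finset.univ.filter fun i : Fin N => (i : ℕ) < S.card with hA
  -- The smallest of the first `S.card` parts: it bounds the parts in `A` from below and those
  -- outside `A` from above.
  set c := μ ⟨S.card - 1, by omega⟩ with hc
  have hcard : (S \ A).card = (A \ S).card :=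
    Finset.card_sdiff_comm (card_filter_val_lt hN).symm
  have h1 : ∑ i ∈ S \ A, μ i ≤ (S \ A).card • c := by
    refine Finset.sum_le_card_nsmul _ _ _ fun i hi => hμ ?_
    simp only [hA, Finset.mem_sdiff, Finset.mem_filter, Finset.mem_univ, true_and, not_lt] at hi
    rw [Fin.le_def]
    simp only
    omega
  have h2 : (A \ S).card • c ≤ ∑ i ∈ A \ S, μ i := by
    refine Finset.card_nsmul_le_sum _ _ _ fun i hi => hμ ?_
    simp only [hA, Finset.mem_sdiff, Finset.mem_filter, Finset.mem_univ, true_and] at hi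
    rw [Fin.le_def]
    simp only
    omega
  calc ∑ i ∈ S, μ i = ∑ i ∈ S ∩ A, μ i + ∑ i ∈ S \ A, μ i := (Finset.sum_inter_add_sum_sdiff _ _ _).symm
    _ ≤ ∑ i ∈ A ∩ S, μ i + ∑ i ∈ A \ S, μ i := by
      rw [Finset.inter_comm]
      rw [hcard] at h1
      exact Nat.add_le_add_left (h1.trans h2) _
    _ = topSum μ S.card := Finset.sum_inter_add_sum_sdiff _ _ _

/-- All partial sums of any rearrangement of `α` are bounded by those of `lam`. -/
def Dominated (lam : Fin N → ℕ) (α : Fin N → ℕ) : Prop :=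
  ∀ S : Finset (Fin N), ∑ i ∈ S, α i ≤ topSum lam S.card

/-- Quantifying over all subsets extends dominance to unordered exponents and makes it permutation
invariant, as needed to control supports. -/
theorem dominated_iff {lam μ : Fin N → ℕ} (hμ : Antitone μ) :
    Dominated lam μ ↔ ∀ k, ∑ i ∈ Finset.Iic k, μ i ≤ ∑ i ∈ Finset.Iic k, lam i := by
  constructor
  · intro h k
    have := h (Finset.Iic k)
    rwa [Fin.card_Iic, topSum_succ] at this
  · intro h S
    refine (sum_le_topSum hμ S).trans ?_
    have hN : S.card ≤ N := by simpa using S.card_le_univ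
    rcases Nat.eq_zero_or_pos S.card with h0 | h0
    · rw [h0]; simp [topSum]
    · have e : S.card = ((⟨S.card - 1, by omega⟩ : Fin N) : ℕ) + 1 := by simp only; omega
      rw [e, topSum_succ, topSum_succ]
      exact h _

theorem dominated_self {lam : Fin N → ℕ} (h : Antitone lam) : Dominated lam lam :=
  fun S => sum_le_topSum h S

theorem Dominated.comp {lam α : Fin N → ℕ} (h : Dominated lam α) (e : Equiv.Perm (Fin N)) :
    Dominated lam (α ∘ e) := by
  intro S
  have := h (S.map e.toEmbedding)
  rwa [Finset.sum_map, Finset.card_map] at this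

theorem Dominated.mono {lam α α' : Fin N → ℕ} (h : Dominated lam α) (hle : α' ≤ α) :
    Dominated lam α' := fun S => (Finset.sum_le_sum fun i _ => hle i).trans (h S)

theorem domLT_iff {lam μ : Fin N → ℕ} (hμ : Antitone μ) :
    DomLT μ lam ↔ Dominated lam μ ∧ μ ≠ lam := by
  rw [DomLT, dominated_iff hμ]

/-- The sum of all partial sums. -/
def rankSum (lam : Fin N → ℕ) : ℕ := ∑ k, ∑ i ∈ Finset.Iic k, lam i

theorem eq_of_sum_Iic_eq {μ ν : Fin N → ℕ}
    (h : ∀ k, ∑ i ∈ Finset.Iic k, μ i = ∑ i ∈ Finset.Iic k, ν i) : μ = ν := by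
  have h' (n : ℕ) (hn : n ≤ N) : topSum μ n = topSum ν n := by
    rcases n with _ | n
    · simp [topSum]
    · have := h ⟨n, hn⟩
      rwa [← topSum_succ, ← topSum_succ] at this
  have hs (lam : Fin N → ℕ) (k : Fin N) : topSum lam (k + 1) = topSum lam k + lam k := by
    have e : Finset.univ.filter (fun i : Fin N => (i : ℕ) < (k : ℕ) + 1)
        = insert k (Finset.univ.filter fun i : Fin N => (i : ℕ) < (k : ℕ)) := by
      ext i
      simp only [Finset.mem_filter, Finset.mem_univ, true_and, Finset.mem_insert, Fin.ext_iff]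
      omega
    rw [topSum, topSum, e, Finset.sum_insert (by simp), add_comm]
  funext k
  have h1 := h' (k + 1) k.2
  rw [hs, hs, h' k k.2.le] at h1
  exact Nat.add_left_cancel h1

theorem DomLT.trans {μ ν lam : Fin N → ℕ} (h : DomLT μ ν) (h' : DomLT ν lam) : DomLT μ lam := by
  refine ⟨fun k => (h.1 k).trans (h'.1 k), ?_⟩
  rintro rfl
  exact h.2 (eq_of_sum_Iic_eq fun k => le_antisymm (h.1 k) (h'.1 k))

/-- Supplies a numerical rank for induction and for choosing maximal exponents. -/
theorem DomLT.rankSum_lt {μ lam : Fin N → ℕ} (h : DomLT μ lam) : rankSum μ < rankSum lam := by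
  obtain ⟨k, hk⟩ : ∃ k, ∑ i ∈ Finset.Iic k, μ i ≠ ∑ i ∈ Finset.Iic k, lam i := by
    by_contra! hc
    exact h.2 (eq_of_sum_Iic_eq hc)
  exact Finset.sum_lt_sum (fun k _ => h.1 k) ⟨k, Finset.mem_univ k, lt_of_le_of_ne (h.1 k) hk⟩

/-! ### Eigenvalues -/

/-- Abel summation. -/
theorem mul_sum_le_sum_mul {n : ℕ} (c d : Fin (n + 1) → ℤ) (hc : Antitone c)
    (hd : ∀ k, 0 ≤ ∑ i, if i ≤ k then d i else 0) :
    c (Fin.last n) * ∑ i, d i ≤ ∑ i, c i * d i := by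
  induction n with
  | zero => simp
  | succ n ih =>
    have h1 := ih (fun i => c i.castSucc) (fun i => d i.castSucc)
      (fun i j h => hc (Fin.castSucc_le_castSucc_iff.mpr h)) (fun k => by
        have := hd k.castSucc
        rw [Fin.sum_univ_castSucc] at this
        simpa [Fin.castSucc_le_castSucc_iff] using this)
    have h2 : 0 ≤ ∑ i : Fin (n + 1), d i.castSucc := by
      have := hd (Fin.last n).castSucc
      rw [Fin.sum_univ_castSucc] at this
      simpa [Fin.castSucc_le_castSucc_iff, Fin.le_last] using this
    have h3 : c (Fin.last (n + 1)) ≤ c (Fin.last n).castSucc := hc (Fin.le_last _)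
    rw [Fin.sum_univ_castSucc, Fin.sum_univ_castSucc (f := fun i => c i * d i)]
    nlinarith

theorem sum_mul_nonneg_of_antitone (c d : Fin N → ℤ) (hc : Antitone c)
    (hd : ∀ k, 0 ≤ ∑ i ∈ Finset.Iic k, d i) (h0 : ∑ i, d i = 0) : 0 ≤ ∑ i, c i * d i := by
  cases N with
  | zero => simp
  | succ n =>
    have := mul_sum_le_sum_mul c d hc fun k => by
      rw [← Finset.sum_filter]
      convert hd k using 2
      ext i; simp
    rwa [h0, mul_zero] at this

/-- The eigenvalue of `∑_j (X_j D^A_j)²` belonging to `lam`. -/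
def jackEigenvalue (β : ℕ) (lam : Fin N → ℕ) : ℤ :=
  ∑ j, ((lam j : ℤ) ^ 2 + β * ∑ k ∈ Finset.Ioi j, ((lam j : ℤ) - lam k))

theorem sum_sum_Ioi_sub (lam : Fin N → ℕ) :
    ∑ j, ∑ k ∈ Finset.Ioi j, ((lam j : ℤ) - lam k)
      = ∑ j : Fin N, ((N : ℤ) - 1 - 2 * (j : ℕ)) * lam j := by
  simp only [Finset.sum_sub_distrib]
  rw [Finset.sum_comm' (s := Finset.univ) (t := fun j : Fin N => Finset.Ioi j)
    (t' := Finset.univ) (s' := fun k => Finset.Iio k) (f := fun _ k => (lam k : ℤ)) (by simp),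
    ← Finset.sum_sub_distrib]
  refine Finset.sum_congr rfl fun j _ => ?_
  simp only [Finset.sum_const, Fin.card_Ioi, Fin.card_Iio, nsmul_eq_mul, Nat.sub_sub]
  rw [Nat.cast_sub (by omega)]
  push_cast
  ring

/-- Expand `lam² = μ² + (lam - μ)² + 2 μ (lam - μ)`. Abel summation bounds the cross term and the
`β` term, both having antitone coefficients; the squares give strictness. -/
theorem jackEigenvalue_lt (β : ℕ) {μ lam : Fin N → ℕ} (hμ : Antitone μ)
    (h : DomLT μ lam) (hw : ∑ i, μ i = ∑ i, lam i) :
    jackEigenvalue β μ < jackEigenvalue β lam := by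
  have hd (k : Fin N) : 0 ≤ ∑ i ∈ Finset.Iic k, ((lam i : ℤ) - μ i) := by
    rw [Finset.sum_sub_distrib, sub_nonneg]
    exact_mod_cast h.1 k
  have h0 : ∑ i, ((lam i : ℤ) - μ i) = 0 := by
    rw [Finset.sum_sub_distrib, sub_eq_zero]
    exact_mod_cast hw.symm
  have h1 := sum_mul_nonneg_of_antitone (fun i => (μ i : ℤ)) _
    (fun i j hij => Int.ofNat_le.mpr (hμ hij)) hd h0
  have h2 := sum_mul_nonneg_of_antitone (fun i : Fin N => (N : ℤ) - 1 - 2 * (i : ℕ)) _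
    (fun i j hij => by
      have : (i : ℕ) ≤ j := hij
      simp only
      omega) hd h0
  have h3 : 0 < ∑ i, ((lam i : ℤ) - μ i) ^ 2 := by
    obtain ⟨i, hi⟩ := Function.ne_iff.mp h.2
    refine Finset.sum_pos' (fun i _ => sq_nonneg _) ⟨i, Finset.mem_univ i, ?_⟩
    refine sq_pos_of_ne_zero (sub_ne_zero.mpr ?_)
    exact_mod_cast hi.symm
  have e1 : ∑ i, (lam i : ℤ) ^ 2 = ∑ i, (μ i : ℤ) ^ 2 + ∑ i, ((lam i : ℤ) - μ i) ^ 2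
      + 2 * ∑ i, (μ i : ℤ) * ((lam i : ℤ) - μ i) := by
    rw [Finset.mul_sum, ← Finset.sum_add_distrib, ← Finset.sum_add_distrib]
    exact Finset.sum_congr rfl fun i _ => by ring
  have e2 : ∑ i : Fin N, ((N : ℤ) - 1 - 2 * (i : ℕ)) * ((lam i : ℤ) - μ i)
      = ∑ i : Fin N, ((N : ℤ) - 1 - 2 * (i : ℕ)) * lam i
        - ∑ i : Fin N, ((N : ℤ) - 1 - 2 * (i : ℕ)) * μ i := by
    rw [← Finset.sum_sub_distrib]
    exact Finset.sum_congr rfl fun i _ => by ring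
  have hβ : (0 : ℤ) ≤ β := by positivity
  simp only [jackEigenvalue, Finset.sum_add_distrib, ← Finset.mul_sum, sum_sum_Ioi_sub]
  rw [e2] at h2
  nlinarith [mul_nonneg hβ h2]

/-! ### Monomial symmetric polynomials -/

theorem coeff_mono (μ : Fin N → ℕ) (α : Fin N →₀ ℕ) :
    (mono μ).coeff α = if ∃ w : Equiv.Perm (Fin N), μ ∘ w = α then 1 else 0 := by
  have h (x : Fin N → ℕ) : (monomial (Finsupp.equivFunOnFinite.symm x) (1 : ℂ)).coeff α
      = if x = α then 1 else 0 := by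
    rw [coeff_monomial]
    exact if_congr ⟨fun e => by rw [← e]; rfl, fun e => by ext i; rw [← e]; rfl⟩ rfl rfl
  rw [mono, coeff_sum, Finset.sum_congr rfl fun x _ => h x, Finset.sum_ite_eq']
  exact if_congr (by simp) rfl rfl

theorem coeff_mono_self (μ : Fin N → ℕ) :
    (mono μ).coeff (Finsupp.equivFunOnFinite.symm μ) = 1 := by
  rw [coeff_mono, if_pos ⟨1, rfl⟩]

theorem eq_of_antitone_comp {μ ν : Fin N → ℕ} (hμ : Antitone μ) (hν : Antitone ν)
    (w : Equiv.Perm (Fin N)) (h : μ ∘ w = ν) : μ = ν := by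
  have h1 : Monotone ((OrderDual.toDual ∘ μ) ∘ (1 : Equiv.Perm (Fin N))) := fun i j hij => hμ hij
  have h2 : Monotone ((OrderDual.toDual ∘ μ) ∘ w) := by
    rw [Function.comp_assoc, h]; exact fun i j hij => hν hij
  have h3 := Tuple.unique_monotone h1 h2
  rw [← h]
  exact h3

theorem coeff_mono_of_ne {μ ν : Fin N → ℕ} (hμ : Antitone μ) (hν : Antitone ν) (h : μ ≠ ν) :
    (mono μ).coeff (Finsupp.equivFunOnFinite.symm ν) = 0 := by
  rw [coeff_mono, if_neg]
  rintro ⟨w, hw⟩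
  exact h (eq_of_antitone_comp hμ hν w hw)

theorem exists_antitone_comp (α : Fin N → ℕ) : ∃ w : Equiv.Perm (Fin N), Antitone (α ∘ w) :=
  ⟨Tuple.sort (OrderDual.toDual ∘ α), fun _ _ hij =>
    Tuple.monotone_sort (OrderDual.toDual ∘ α) hij⟩

theorem coeff_comp_of_isSymmetric {f : Poly N} (hf : f.IsSymmetric) (α : Fin N → ℕ)
    (w : Equiv.Perm (Fin N)) : f.coeff (Finsupp.equivFunOnFinite.symm (α ∘ w))
      = f.coeff (Finsupp.equivFunOnFinite.symm α) := by
  have e : Finsupp.mapDomain w (Finsupp.equivFunOnFinite.symm (α ∘ w))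
      = Finsupp.equivFunOnFinite.symm α := by
    ext i
    rw [Finsupp.mapDomain_equiv_apply]
    simp
  rw [← e]
  conv_rhs => rw [← hf w]
  rw [coeff_rename_mapDomain _ w.injective]

theorem isSymmetric_mono (μ : Fin N → ℕ) : (mono μ).IsSymmetric := by
  intro e
  ext α
  obtain ⟨α, rfl⟩ : ∃ α', α = Finsupp.mapDomain e α' :=
    ⟨Finsupp.mapDomain e.symm α, by rw [← Finsupp.mapDomain_comp]; simp⟩
  rw [coeff_rename_mapDomain _ e.injective, coeff_mono, coeff_mono]
  refine if_congr ⟨?_, ?_⟩ rfl rfl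
  · rintro ⟨w, hw⟩
    refine ⟨w * e⁻¹, ?_⟩
    funext i
    have := congrFun hw (e.symm i)
    rw [Finsupp.mapDomain_equiv_apply]
    exact this
  · rintro ⟨w, hw⟩
    refine ⟨w * e, ?_⟩
    funext i
    have := congrFun hw (e i)
    rw [Finsupp.mapDomain_equiv_apply, Equiv.symm_apply_apply] at this
    exact this

/-- Subtracting a multiple of one orbit sum shrinks the support. Keeping track of which `μ` occur
transfers support bounds to spans. -/
theorem IsSymmetric.mem_span_mono {f : Poly N} (hf : f.IsSymmetric) :
    f ∈ Submodule.span ℂ (mono '' {μ : Fin N → ℕ | Antitone μ ∧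
      f.coeff (Finsupp.equivFunOnFinite.symm μ) ≠ 0}) := by
  induction hn : f.support.card using Nat.strong_induction_on generalizing f with
  | _ n ih =>
    subst hn
    rcases eq_or_ne f 0 with rfl | h0
    · exact Submodule.zero_mem _
    obtain ⟨α, hα⟩ := Finset.nonempty_iff_ne_empty.mpr (mt support_eq_empty.mp h0)
    obtain ⟨w, hw⟩ := exists_antitone_comp α
    set μ : Fin N → ℕ := α ∘ w with hμ
    have hc := coeff_comp_of_isSymmetric hf α w
    have hα' : Finsupp.equivFunOnFinite.symm (α : Fin N → ℕ) = α := by ext; rfl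
    rw [hα', ← hμ] at hc
    rw [mem_support_iff] at hα
    set g := f - f.coeff α • mono μ with hg
    have hgs : g.IsSymmetric := hf.sub ((isSymmetric_mono μ).smul _)
    have hgc (δ : Fin N →₀ ℕ) (hδ : g.coeff δ ≠ 0) : f.coeff δ ≠ 0 ∧ δ ≠ α := by
      rw [hg, coeff_sub, coeff_smul, coeff_mono] at hδ
      by_cases hex : ∃ w' : Equiv.Perm (Fin N), μ ∘ w' = δ
      · obtain ⟨w', hw'⟩ := hex
        have h1 := coeff_comp_of_isSymmetric hf μ w'
        have h2 : Finsupp.equivFunOnFinite.symm (μ ∘ w') = δ := by rw [hw']; ext; rfl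
        rw [h2, hc] at h1
        rw [if_pos ⟨w', hw'⟩, h1] at hδ
        simp at hδ
      · rw [if_neg hex] at hδ
        refine ⟨by simpa using hδ, ?_⟩
        rintro rfl
        exact hex ⟨w.symm, by funext i; simp [hμ]⟩
    have hlt : g.support.card < f.support.card := by
      refine Finset.card_lt_card ⟨fun δ hδ => ?_, fun hsub => ?_⟩
      · rw [mem_support_iff] at hδ ⊢; exact (hgc δ hδ).1
      · have := hsub (mem_support_iff.mpr hα)
        rw [mem_support_iff] at this
        exact (hgc α this).2 rfl
    have hg2 := ih _ hlt hgs rfl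
    have hg3 := Submodule.span_mono (Set.image_mono (f := mono) fun ν
      (hν : ν ∈ {μ : Fin N → ℕ | Antitone μ ∧ g.coeff (Finsupp.equivFunOnFinite.symm μ) ≠ 0}) =>
      (⟨hν.1, (hgc _ hν.2).1⟩ : ν ∈ {μ : Fin N → ℕ | Antitone μ ∧
        f.coeff (Finsupp.equivFunOnFinite.symm μ) ≠ 0})) hg2
    have hμ2 : μ ∈ {μ : Fin N → ℕ | Antitone μ ∧
        f.coeff (Finsupp.equivFunOnFinite.symm μ) ≠ 0} := ⟨hw, by rwa [hc]⟩
    have hμ3 := Submodule.smul_mem _ (f.coeff α) (Submodule.subset_span (R := ℂ)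
      (Set.mem_image_of_mem mono hμ2))
    have e := Submodule.add_mem _ hg3 hμ3
    rwa [hg, sub_add_cancel] at e

/-! ### Triangularity -/

/-- The exponents dominated by `lam` whose total degree satisfies `p`. -/
def domSet (lam : Fin N → ℕ) (p : ℕ → Prop) : Set (Fin N →₀ ℕ) :=
  {α | Dominated lam α ∧ p (∑ i, α i)}

theorem restrictSupport_map_le {s t : Set (Fin N →₀ ℕ)} (T : Module.End ℂ (Poly N))
    (h : ∀ α ∈ s, T (monomial α 1) ∈ restrictSupport ℂ t) {f : Poly N}
    (hf : f ∈ restrictSupport ℂ s) : T f ∈ restrictSupport ℂ t := by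
  rw [restrictSupport_eq_span] at hf
  induction hf using Submodule.span_induction with
  | mem x hx => obtain ⟨α, hα, rfl⟩ := hx; exact h α hα
  | zero => rw [map_zero]; exact Submodule.zero_mem _
  | add f g _ _ hf hg => rw [map_add]; exact Submodule.add_mem _ hf hg
  | smul c f _ hf => rw [map_smul]; exact Submodule.smul_mem _ c hf

theorem monomial_mem_of_mem {s : Set (Fin N →₀ ℕ)} {α : Fin N →₀ ℕ} (h : α ∈ s) (c : ℂ) :
    monomial α c ∈ restrictSupport ℂ s := by
  rw [monomial_mem_restrictSupport]; exact Or.inl h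

theorem mapDomain_mem_domSet {lam : Fin N → ℕ} {p : ℕ → Prop} {α : Fin N →₀ ℕ}
    (hα : α ∈ domSet lam p) (e : Equiv.Perm (Fin N)) : Finsupp.mapDomain e α ∈ domSet lam p := by
  have h (i : Fin N) : Finsupp.mapDomain e α i = α (e.symm i) := Finsupp.mapDomain_equiv_apply _ _
  refine ⟨?_, ?_⟩
  · have := hα.1.comp e.symm
    rwa [show (α : Fin N → ℕ) ∘ e.symm = Finsupp.mapDomain e α from funext fun i => (h i).symm]
      at this
  · simp only [h]
    rw [Equiv.sum_comp e.symm α]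
    exact hα.2

theorem exch_mem_restrictSupport {lam : Fin N → ℕ} {p : ℕ → Prop} (j k : Fin N) {f : Poly N}
    (hf : f ∈ restrictSupport ℂ (domSet lam p)) :
    exch j k f ∈ restrictSupport ℂ (domSet lam p) := by
  refine restrictSupport_map_le (exch j k).toLinearMap (fun α hα => ?_) hf
  rw [AlgHom.toLinearMap_apply, exch, rename_monomial]
  exact monomial_mem_of_mem (mapDomain_mem_domSet hα _) _

theorem sum_add_single (μ : Fin N →₀ ℕ) (S : Finset (Fin N)) (j : Fin N) (p : ℕ) :
    ∑ i ∈ S, (μ + Finsupp.single j p : Fin N →₀ ℕ) i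
      = ∑ i ∈ S, μ i + if j ∈ S then p else 0 := by
  simp only [Finsupp.add_apply, Finset.sum_add_distrib, Finsupp.single_apply, Finset.sum_ite_eq]

/-- Splitting an excess `p + q` over two otherwise equal entries only lowers subset sums, up to the
exchange of `j` and `k`. -/
theorem add_single_add_single_mem_domSet {lam : Fin N → ℕ} {P : ℕ → Prop} {μ : Fin N →₀ ℕ}
    {j k : Fin N} (hμ : μ j = μ k) {p q : ℕ}
    (h : μ + Finsupp.single j (p + q) ∈ domSet lam P) :
    μ + Finsupp.single j p + Finsupp.single k q ∈ domSet lam P := by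
  refine ⟨fun S => ?_, ?_⟩
  · rw [sum_add_single, sum_add_single]
    have hS := h.1 S
    rw [sum_add_single] at hS
    by_cases hj : j ∈ S
    · rw [if_pos hj] at hS ⊢
      refine le_trans ?_ hS
      split_ifs <;> omega
    · by_cases hk : k ∈ S
      -- The bound for `S` itself misses the excess at `j`; its image under the swap contains `j`
      -- and has the same `μ`-sum.
      · have hS' := h.1 (S.map (Equiv.swap j k).toEmbedding)
        have hj' : j ∈ S.map (Equiv.swap j k).toEmbedding :=
          Finset.mem_map.mpr ⟨k, hk, Equiv.swap_apply_right j k⟩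
        rw [Finset.card_map, sum_add_single, if_pos hj', Finset.sum_map] at hS'
        have e : ∑ x ∈ S, μ ((Equiv.swap j k).toEmbedding x) = ∑ x ∈ S, μ x := by
          refine Finset.sum_congr rfl fun x _ => ?_
          rw [Equiv.coe_toEmbedding, Equiv.swap_apply_def]
          split_ifs with h1 h2
          · rw [h1, hμ]
          · rw [h2, hμ]
          · rfl
        rw [e] at hS'
        rw [if_neg hj, if_pos hk]
        omega
      · rw [if_neg hj] at hS ⊢
        rwa [if_neg hk]
  · have := h.2
    rw [sum_add_single, if_pos (Finset.mem_univ _)] at this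
    rwa [sum_add_single, sum_add_single, if_pos (Finset.mem_univ _), if_pos (Finset.mem_univ _),
      add_assoc]

theorem ddA_exch (j k : Fin N) (f : Poly N) : ddA j k (exch j k f) = -ddA j k f := by
  rcases eq_or_ne k j with rfl | h
  · simp
  apply mul_left_cancel₀ (X_sub_X_ne_zero h)
  rw [mul_ddA, exch_exch, mul_neg, mul_ddA, neg_sub]

theorem ddA_X_pow {j k : Fin N} (h : k ≠ j) (n : ℕ) :
    ddA j k (X j ^ n) = ∑ i ∈ Finset.range n, X j ^ i * X k ^ (n - 1 - i) := by
  apply mul_left_cancel₀ (X_sub_X_ne_zero h)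
  rw [mul_ddA, mul_comm, (Commute.all _ _).geom_sum₂_mul, map_pow, exch_X, Equiv.swap_apply_left]

/-- If `α k ≤ α j`, split off a factor symmetric in `j`, `k`; what is left is a geometric sum, and a
further `X j` gives exponents `(i + 1, n - 1 - i)` in place of `(n, 0)`. The other case follows by
antisymmetry. -/
theorem ddA_monomial_mem {lam : Fin N → ℕ} {P : ℕ → Prop} (j k : Fin N) {α : Fin N →₀ ℕ}
    (hα : α ∈ domSet lam P) : ddA j k (monomial α (1 : ℂ)) ∈
      restrictSupport ℂ {α' | α' + Finsupp.single j 1 ∈ domSet lam P} := by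
  rcases eq_or_ne k j with rfl | hjk
  · rw [ddA_self]; exact Submodule.zero_mem _
  have key (α : Fin N →₀ ℕ) (hα : α ∈ domSet lam P) (hle : α k ≤ α j) :
      ddA j k (monomial α (1 : ℂ)) ∈
        restrictSupport ℂ {α' | α' + Finsupp.single j 1 ∈ domSet lam P} := by
    obtain ⟨n, hn⟩ := Nat.exists_eq_add_of_le hle
    obtain ⟨μ, rfl⟩ : ∃ μ, α = μ + Finsupp.single j n :=
      ⟨α - Finsupp.single j n, (tsub_add_cancel_of_le (by
        rw [Finsupp.single_le_iff]; omega)).symm⟩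
    simp only [Finsupp.add_apply, Finsupp.single_eq_same, Finsupp.single_eq_of_ne hjk,
      add_zero] at hn
    have hμ : μ j = μ k := by omega
    have hs : exch j k (monomial μ 1) = monomial μ 1 := by
      rw [exch, rename_monomial]
      refine congrArg (fun m => monomial m (1 : ℂ)) ?_
      ext i
      rw [Finsupp.mapDomain_equiv_apply, Equiv.symm_swap, Equiv.swap_apply_def]
      split_ifs with h1 h2
      · rw [h1, hμ]
      · rw [h2, hμ]
      · rfl
    have h0 : ddA j k (monomial μ 1) = 0 := by
      apply mul_left_cancel₀ (X_sub_X_ne_zero hjk)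
      rw [mul_ddA, hs, sub_self, mul_zero]
    have e : (monomial (μ + Finsupp.single j n) 1 : Poly N) = monomial μ 1 * X j ^ n := by
      rw [X_pow_eq_monomial, monomial_mul, one_mul]
    rw [e, ddA_mul, h0, zero_mul, add_zero, ddA_X_pow hjk, Finset.mul_sum]
    refine Submodule.sum_mem _ fun i hi => ?_
    have hi := Finset.mem_range.mp hi
    rw [X_pow_eq_monomial, X_pow_eq_monomial, monomial_mul, monomial_mul, one_mul, one_mul]
    refine monomial_mem_of_mem ?_ _
    have e2 : μ + (Finsupp.single j i + Finsupp.single k (n - 1 - i)) + Finsupp.single j 1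
        = μ + Finsupp.single j (i + 1) + Finsupp.single k (n - 1 - i) := by
      rw [Finsupp.single_add]; abel
    rw [Set.mem_ofPred_eq, e2]
    refine add_single_add_single_mem_domSet hμ ?_
    rwa [show i + 1 + (n - 1 - i) = n by omega]
  rcases le_total (α k) (α j) with h | h
  · exact key α hα h
  · have h1 := key _ (mapDomain_mem_domSet hα (Equiv.swap j k)) (by
      rw [Finsupp.mapDomain_equiv_apply, Finsupp.mapDomain_equiv_apply]
      simpa using h)
    have h2 : (monomial (Finsupp.mapDomain (Equiv.swap j k) α) 1 : Poly N)
        = exch j k (monomial α 1) := by rw [exch, rename_monomial]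
    rw [h2, ddA_exch] at h1
    simpa using h1

theorem pderiv_monomial_mem {lam : Fin N → ℕ} {P : ℕ → Prop} (j : Fin N) {α : Fin N →₀ ℕ}
    (hα : α ∈ domSet lam P) : pderiv j (monomial α (1 : ℂ)) ∈
      restrictSupport ℂ {α' | α' + Finsupp.single j 1 ∈ domSet lam P} := by
  rw [pderiv_monomial]
  rw [monomial_mem_restrictSupport]
  rcases Nat.eq_zero_or_pos (α j) with h | h
  · exact Or.inr (by simp [h])
  · left
    rwa [Set.mem_ofPred_eq, tsub_add_cancel_of_le (by rw [Finsupp.single_le_iff]; omega)]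

theorem dunklA_mem_shift {lam : Fin N → ℕ} {P : ℕ → Prop} (β : ℕ) (j : Fin N) {f : Poly N}
    (hf : f ∈ restrictSupport ℂ (domSet lam P)) : dunklA β j f ∈
      restrictSupport ℂ {α' | α' + Finsupp.single j 1 ∈ domSet lam P} := by
  rw [dunklA_apply]
  exact Submodule.add_mem _
    (restrictSupport_map_le (pderiv j).toLinearMap (fun _ => pderiv_monomial_mem j) hf)
    (Submodule.smul_mem _ _ (Submodule.sum_mem _ fun k _ =>
      restrictSupport_map_le (ddA j k) (fun _ => ddA_monomial_mem j k) hf))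

theorem dunklA_mem {lam : Fin N → ℕ} {P : ℕ → Prop} (β : ℕ) (j : Fin N) {f : Poly N}
    (hf : f ∈ restrictSupport ℂ (domSet lam P)) :
    dunklA β j f ∈ restrictSupport ℂ (domSet lam fun n => P (n + 1)) := by
  refine restrictSupport_mono ℂ ?_ (dunklA_mem_shift β j hf)
  rintro α ⟨h1, h2⟩
  refine ⟨h1.mono fun i => ?_, ?_⟩
  · simp
  · rwa [sum_add_single, if_pos (Finset.mem_univ _)] at h2

theorem X_mul_mem_of_shift {s : Set (Fin N →₀ ℕ)} (j : Fin N) {f : Poly N}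
    (hf : f ∈ restrictSupport ℂ {α | α + Finsupp.single j 1 ∈ s}) :
    X j * f ∈ restrictSupport ℂ s := by
  refine restrictSupport_map_le (mulVar j) (fun α hα => ?_) hf
  have e : mulVar j (monomial α (1 : ℂ)) = monomial (α + Finsupp.single j 1) 1 := by
    rw [mulVar, LinearMap.mulLeft_apply, X, monomial_mul, one_mul, add_comm]
  rw [e]
  exact monomial_mem_of_mem (show α + Finsupp.single j 1 ∈ s from hα) _

theorem eulerA_mem {lam : Fin N → ℕ} {P : ℕ → Prop} (β : ℕ) (j : Fin N) {f : Poly N}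
    (hf : f ∈ restrictSupport ℂ (domSet lam P)) :
    eulerA β j f ∈ restrictSupport ℂ (domSet lam P) :=
  X_mul_mem_of_shift j (dunklA_mem_shift β j hf)

theorem X_mul_ddA_mem {lam : Fin N → ℕ} {P : ℕ → Prop} (j k : Fin N) {f : Poly N}
    (hf : f ∈ restrictSupport ℂ (domSet lam P)) :
    X j * ddA j k f ∈ restrictSupport ℂ (domSet lam P) :=
  X_mul_mem_of_shift j (restrictSupport_map_le (ddA j k) (fun _ => ddA_monomial_mem j k) hf)

theorem laplaceA_mem {lam : Fin N → ℕ} {P : ℕ → Prop} (β : ℕ) (γ : ℝ) {f : Poly N}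
    (hf : f ∈ restrictSupport ℂ (domSet lam P)) :
    laplaceA β γ f ∈ restrictSupport ℂ (domSet lam fun n => P (n + 1)) := by
  refine Submodule.sum_mem _ fun j _ => ?_
  have h := dunklA_mem β j hf
  exact Submodule.add_mem _ (Submodule.add_mem _ (Submodule.smul_mem _ _ (eulerA_mem β j h))
    (Submodule.smul_mem _ _ h)) (Submodule.smul_mem _ _ (Submodule.sum_mem _ fun l _ =>
      exch_mem_restrictSupport j l h))

theorem sutherland_mem {lam : Fin N → ℕ} {P : ℕ → Prop} (β : ℕ) {f : Poly N}
    (hs : f.IsSymmetric) (hf : f ∈ restrictSupport ℂ (domSet lam P)) :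
    sutherland N β f ∈ restrictSupport ℂ (domSet lam P) := by
  rw [sutherland_of_isSymmetric β hs]
  exact Submodule.add_mem _ (Submodule.sum_mem _ fun j _ => eulerA_mem β j (eulerA_mem β j hf))
    (Submodule.smul_mem _ _ hf)

theorem isSymmetric_sutherland (β : ℕ) {f : Poly N} (hs : f.IsSymmetric) :
    (sutherland N β f).IsSymmetric := by
  intro e
  rw [sutherland_of_isSymmetric β hs, map_add, map_smul, hs e, map_sum]
  simp only [rename_eulerA, hs e]
  rw [Equiv.sum_comp e fun j => eulerA β j (eulerA β j f)]

theorem isSymmetric_laplaceA (β : ℕ) (γ : ℝ) {f : Poly N} (hs : f.IsSymmetric) :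
    (laplaceA β γ f).IsSymmetric := by
  intro e
  apply expand_injective (R := ℂ) (σ := Fin N) two_pos
  rw [← rename_expand, ← dunklLaplace_expand, rename_dunklLaplace, rename_expand, hs e]

/-! ### Leading coefficients -/

theorem coeff_of_notMem {s : Set (Fin N →₀ ℕ)} {f : Poly N} (hf : f ∈ restrictSupport ℂ s)
    {α : Fin N →₀ ℕ} (h : α ∉ s) : f.coeff α = 0 := by
  by_contra hc
  exact h (hf (mem_support_iff.mpr hc))

/-- The exponent `lam + e_a - e_b` is not dominated: its partial sum up to `a` exceeds that of `lam`
by one. -/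
theorem coeff_X_mul_eq_zero {lam : Fin N →₀ ℕ} {P : ℕ → Prop} {a b : Fin N} (hab : a < b)
    {f : Poly N} (hf : f ∈ restrictSupport ℂ (domSet lam P)) :
    (X b * f).coeff (lam + Finsupp.single a 1) = 0 := by
  rw [coeff_X_mul']
  split_ifs with h
  · refine coeff_of_notMem hf fun hmem => ?_
    have h1 := hmem.1 (Finset.Iic a)
    rw [Fin.card_Iic, topSum_succ] at h1
    have h2 : ∑ i ∈ Finset.Iic a, (lam + Finsupp.single a 1 - Finsupp.single b 1 : Fin N →₀ ℕ) i
        = ∑ i ∈ Finset.Iic a, (lam + Finsupp.single a 1 : Fin N →₀ ℕ) i := by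
      refine Finset.sum_congr rfl fun i hi => ?_
      have hib : i ≠ b := fun e => absurd (Finset.mem_Iic.mp hi) (by rw [e]; exact not_le.mpr hab)
      rw [Finsupp.tsub_apply, Finsupp.single_eq_of_ne hib, Nat.sub_zero]
    rw [h2, sum_add_single, if_pos (Finset.mem_Iic.mpr le_rfl)] at h1
    omega
  · rfl

/-- Compare coefficients in `(X_j - X_k) Q = X_j (f - s_{jk} f)`, `Q = X_j * ddA j k f`, at `lam`
raised in the earlier of the positions `j`, `k`. Multiplication by the later variable contributes
nothing there. -/
theorem coeff_X_mul_ddA {lam : Fin N →₀ ℕ} {P : ℕ → Prop} (j k : Fin N) {f : Poly N}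
    (hf : f ∈ restrictSupport ℂ (domSet lam P)) :
    (X j * ddA j k f).coeff lam = if j < k then f.coeff lam - (exch j k f).coeff lam else 0 := by
  have hQ := X_mul_ddA_mem j k hf
  have hG := Submodule.sub_mem _ hf (exch_mem_restrictSupport j k hf)
  have e : X j * (X j * ddA j k f) - X k * (X j * ddA j k f) = X j * (f - exch j k f) := by
    rw [← mul_ddA]; ring
  rcases lt_trichotomy j k with h | rfl | h
  · have h1 := congrArg (coeff (lam + Finsupp.single j 1)) e
    rw [coeff_sub, coeff_X_mul_eq_zero h hQ, add_comm lam, coeff_X_mul, coeff_X_mul, sub_zero,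
      coeff_sub] at h1
    rw [if_pos h, h1]
  · simp
  · have h1 := congrArg (coeff (lam + Finsupp.single k 1)) e
    rw [coeff_sub, coeff_X_mul_eq_zero h hQ, coeff_X_mul_eq_zero h hG, add_comm lam, coeff_X_mul,
      zero_sub, neg_eq_zero] at h1
    rw [if_neg h.not_gt, h1]

theorem coeff_X_mul_pderiv (j : Fin N) (f : Poly N) (α : Fin N →₀ ℕ) :
    (X j * pderiv j f).coeff α = α j * f.coeff α := by
  induction f using MvPolynomial.induction_on' with
  | monomial m a =>
    have h : (X j * pderiv j (monomial m a) : Poly N) = (m j : ℂ) • monomial m a := by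
      rw [X_mul_pderiv_monomial, Nat.cast_smul_eq_nsmul]
    rw [h, coeff_smul, coeff_monomial]
    split_ifs with hm
    · rw [hm, smul_eq_mul]
    · simp
  | add f g hf hg => rw [map_add, mul_add, coeff_add, hf, hg, coeff_add]; ring

theorem coeff_sutherland {lam : Fin N →₀ ℕ} {P : ℕ → Prop} (β : ℕ) {f : Poly N}
    (hs : f.IsSymmetric) (hf : f ∈ restrictSupport ℂ (domSet lam P)) :
    (sutherland N β f).coeff lam
      = ((jackEigenvalue β lam : ℂ) + sutherlandShift N β) * f.coeff lam := by
  have hG (j : Fin N) : eulerA β j f = X j * pderiv j f := by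
    rw [eulerA_apply, dunklA_of_isSymmetric β hs]
  have h1 (j : Fin N) : (eulerA β j (eulerA β j f)).coeff lam = ((lam j : ℂ) ^ 2 + β *
      ∑ k ∈ Finset.Ioi j, ((lam j : ℂ) - lam k)) * f.coeff lam := by
    rw [eulerA_apply, dunklA_apply, mul_add, coeff_add, coeff_X_mul_pderiv, mul_smul_comm,
      coeff_smul, Finset.mul_sum, coeff_sum]
    simp only [coeff_X_mul_ddA _ _ (eulerA_mem β j hf), exch_eulerA_of_isSymmetric β hs]
    rw [← Finset.sum_filter]
    simp only [hG, coeff_X_mul_pderiv, ← sub_mul]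
    rw [← Finset.sum_mul, smul_eq_mul]
    have e : Finset.univ.filter (fun k => j < k) = Finset.Ioi j := by ext k; simp
    rw [e]
    ring
  rw [sutherland_of_isSymmetric β hs, coeff_add, coeff_smul, coeff_sum, jackEigenvalue]
  simp only [h1]
  rw [← Finset.sum_mul]
  push_cast
  rw [smul_eq_mul]
  ring

/-! ### Spans of monomial symmetric polynomials -/

/-- The antitone `μ` strictly below `lam` whose weight satisfies `p`. -/
def lowerSet (lam : Fin N → ℕ) (p : ℕ → Prop) : Set (Fin N → ℕ) :=
  {μ | Antitone μ ∧ DomLT μ lam ∧ p (∑ i, μ i)}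

theorem domSet_mono {lam : Fin N → ℕ} {p q : ℕ → Prop} (h : ∀ n, p n → q n) :
    domSet lam p ⊆ domSet lam q := fun _ hα => ⟨hα.1, h _ hα.2⟩

theorem mono_mem_restrictSupport {lam μ : Fin N → ℕ} {p : ℕ → Prop} (h : Dominated lam μ)
    (hp : p (∑ i, μ i)) : mono μ ∈ restrictSupport ℂ (domSet lam p) := by
  intro α hα
  have hα' : (mono μ).coeff α ≠ 0 := mem_support_iff.mp hα
  rw [coeff_mono] at hα'
  obtain ⟨w, hw⟩ : ∃ w : Equiv.Perm (Fin N), μ ∘ w = α := by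
    by_contra hc
    exact hα' (if_neg hc)
  refine ⟨hw ▸ h.comp w, ?_⟩
  rw [← hw]
  simpa [Equiv.sum_comp w μ] using hp

theorem isSymmetric_of_mem_span {s : Set (Fin N → ℕ)} {f : Poly N}
    (hf : f ∈ Submodule.span ℂ (mono '' s)) : f.IsSymmetric := by
  induction hf using Submodule.span_induction with
  | mem x hx => obtain ⟨μ, _, rfl⟩ := hx; exact isSymmetric_mono μ
  | zero => exact IsSymmetric.zero
  | add f g _ _ hf hg => exact hf.add hg
  | smul c f _ hf => exact hf.smul c

/-- Turns span membership into conditions that can be checked directly on the image of an operator.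
-/
theorem mem_span_lowerSet_iff {lam : Fin N → ℕ} (hlam : Antitone lam) {p : ℕ → Prop} (f : Poly N) :
    f ∈ Submodule.span ℂ (mono '' lowerSet lam p) ↔ f.IsSymmetric ∧
      f ∈ restrictSupport ℂ (domSet lam p) ∧
      f.coeff (Finsupp.equivFunOnFinite.symm lam) = 0 := by
  constructor
  · intro hf
    refine ⟨isSymmetric_of_mem_span hf, ?_, ?_⟩
    · refine Submodule.span_le.mpr ?_ hf
      rintro _ ⟨μ, ⟨h1, h2, h3⟩, rfl⟩
      exact mono_mem_restrictSupport ((domLT_iff h1).mp h2).1 h3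
    · induction hf using Submodule.span_induction with
      | mem x hx =>
        obtain ⟨μ, ⟨h1, h2, _⟩, rfl⟩ := hx
        exact coeff_mono_of_ne h1 hlam h2.2
      | zero => rfl
      | add f g _ _ hf hg => rw [coeff_add, hf, hg, add_zero]
      | smul c f _ hf => rw [coeff_smul, hf, smul_zero]
  · rintro ⟨hs, hf, h0⟩
    refine Submodule.span_mono (Set.image_mono ?_) (IsSymmetric.mem_span_mono hs)
    rintro μ ⟨h1, h2⟩
    have hm : Finsupp.equivFunOnFinite.symm μ ∈ domSet lam p := hf (mem_support_iff.mpr h2)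
    refine ⟨h1, (domLT_iff h1).mpr ⟨hm.1, ?_⟩, hm.2⟩
    rintro rfl
    exact h2 h0

theorem finite_lowerSet (lam : Fin N → ℕ) (p : ℕ → Prop) : (lowerSet lam p).Finite := by
  refine (Set.finite_Iic fun _ : Fin N => ∑ i, lam i).subset ?_
  rintro μ ⟨_, h, _⟩ i
  calc μ i ≤ ∑ k ∈ Finset.Iic i, μ k :=
        Finset.single_le_sum (fun _ _ => Nat.zero_le _) (Finset.mem_Iic.mpr le_rfl)
    _ ≤ ∑ k ∈ Finset.Iic i, lam k := h.1 i
    _ ≤ ∑ k, lam k := Finset.sum_le_sum_of_subset (Finset.subset_univ _)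

/-! ### Existence and uniqueness of Jack polynomials -/

theorem coeff_sutherland_mono_self (β : ℕ) {μ : Fin N → ℕ} (hμ : Antitone μ) :
    (sutherland N β (mono μ)).coeff (Finsupp.equivFunOnFinite.symm μ)
      = (jackEigenvalue β μ : ℂ) + sutherlandShift N β := by
  have h := mono_mem_restrictSupport (p := fun _ => True) (dominated_self hμ) trivial
  have h2 := coeff_sutherland (lam := Finsupp.equivFunOnFinite.symm μ) β (isSymmetric_mono μ) h
  rw [h2, coeff_mono_self, mul_one]
  rfl

/-- Take `μ` of maximal rank among the partitions in `f`. By triangularity no other `m_ν` in `f`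
contributes to the coefficient at `μ`, so `c` is the diagonal entry there. -/
theorem exists_eigenvalue_eq (β : ℕ) {f : Poly N} (hs : f.IsSymmetric) (h0 : f ≠ 0) {c : ℂ}
    (hc : sutherland N β f = c • f) : ∃ μ : Fin N → ℕ, Antitone μ ∧
      f.coeff (Finsupp.equivFunOnFinite.symm μ) ≠ 0 ∧
      c = jackEigenvalue β μ + sutherlandShift N β := by
  classical
  set A : Finset (Fin N →₀ ℕ) :=
    f.support.filter fun α : Fin N →₀ ℕ => Antitone (α : Fin N → ℕ) with hA
  have hne : A.Nonempty := by
    obtain ⟨α, hα⟩ := Finset.nonempty_iff_ne_empty.mpr (mt support_eq_empty.mp h0)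
    obtain ⟨w, hw⟩ := exists_antitone_comp α
    refine ⟨Finsupp.equivFunOnFinite.symm (α ∘ w), Finset.mem_filter.mpr ⟨?_, hw⟩⟩
    rw [mem_support_iff, coeff_comp_of_isSymmetric hs, Finsupp.equivFunOnFinite_symm_coe]
    exact mem_support_iff.mp hα
  obtain ⟨μ, hμA, hmax⟩ := A.exists_max_image (fun α : Fin N →₀ ℕ => rankSum (α : Fin N → ℕ)) hne
  obtain ⟨hμs, hμ⟩ := Finset.mem_filter.mp hμA
  have hμc := mem_support_iff.mp hμs
  have e : Finsupp.equivFunOnFinite.symm (μ : Fin N → ℕ) = μ := Finsupp.equivFunOnFinite_symm_coe μ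
  refine ⟨μ, hμ, by rwa [e], ?_⟩
  set g := f - f.coeff μ • mono μ with hg
  have hgs : g.IsSymmetric := hs.sub ((isSymmetric_mono _).smul _)
  have hgc : (sutherland N β g).coeff μ = 0 := by
    have hspan := IsSymmetric.mem_span_mono hgs
    have hle : Submodule.span ℂ (mono '' {ν : Fin N → ℕ | Antitone ν ∧
        g.coeff (Finsupp.equivFunOnFinite.symm ν) ≠ 0})
        ≤ LinearMap.ker ((lcoeff ℂ μ).comp (sutherland N β)) := by
      rw [Submodule.span_le]
      rintro _ ⟨ν, ⟨hν, hνc⟩, rfl⟩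
      have hne : ν ≠ μ := by
        rintro rfl
        have h1 := coeff_mono_self (μ : Fin N → ℕ)
        rw [e] at h1
        rw [e, hg, coeff_sub, coeff_smul, h1] at hνc
        simp at hνc
      have hνf : f.coeff (Finsupp.equivFunOnFinite.symm ν) ≠ 0 := by
        rw [hg, coeff_sub, coeff_smul, coeff_mono_of_ne hμ hν hne.symm] at hνc
        simpa using hνc
      have hνA : Finsupp.equivFunOnFinite.symm ν ∈ A :=
        Finset.mem_filter.mpr ⟨mem_support_iff.mpr hνf, hν⟩
      have hr : rankSum ν ≤ rankSum (μ : Fin N → ℕ) := hmax _ hνA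
      have hm := sutherland_mem β (isSymmetric_mono ν)
        (mono_mem_restrictSupport (p := fun _ => True) (dominated_self hν) trivial)
      rw [SetLike.mem_coe, LinearMap.mem_ker, LinearMap.comp_apply, lcoeff_apply]
      refine coeff_of_notMem hm fun hmem => ?_
      exact absurd ((domLT_iff hμ).mpr ⟨hmem.1, hne.symm⟩).rankSum_lt (not_lt.mpr hr)
    exact hle hspan
  have hf : f = g + f.coeff μ • mono μ := by rw [hg]; ring
  have h1 := congrArg (coeff μ) hc
  conv at h1 => lhs; rw [hf]
  rw [map_add, map_smul, coeff_add, hgc, coeff_smul, coeff_smul, zero_add] at h1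
  have h2 := coeff_sutherland_mono_self β hμ
  rw [e] at h2
  rw [h2, smul_eq_mul, smul_eq_mul, mul_comm] at h1
  exact (mul_right_cancel₀ hμc h1).symm

theorem eq_zero_of_mem_lower (β : ℕ) {lam : Fin N → ℕ} (hlam : Antitone lam) {f : Poly N}
    (hf : f ∈ Submodule.span ℂ (mono '' lowerSet lam (· = ∑ i, lam i)))
    (hc : sutherland N β f = ((jackEigenvalue β lam : ℂ) + sutherlandShift N β) • f) : f = 0 := by
  by_contra h0
  obtain ⟨hs, hsup, hl⟩ := (mem_span_lowerSet_iff hlam f).mp hf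
  obtain ⟨μ, hμ, hμc, h⟩ := exists_eigenvalue_eq β hs h0 hc
  have hm : Finsupp.equivFunOnFinite.symm μ ∈ domSet lam _ := hsup (mem_support_iff.mpr hμc)
  have hne : μ ≠ lam := by rintro rfl; exact hμc hl
  have hlt := jackEigenvalue_lt β hμ ((domLT_iff hμ).mpr ⟨hm.1, hne⟩) hm.2
  have h' : jackEigenvalue β lam = jackEigenvalue β μ := by exact_mod_cast add_right_cancel h
  omega

theorem isJack_def (β : ℕ) (lam : Fin N → ℕ) (J : Poly N) : IsJack β lam J ↔
    J - mono lam ∈ Submodule.span ℂ (mono '' lowerSet lam (· = ∑ i, lam i)) ∧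
      ∃ c : ℂ, sutherland N β J = c • J := Iff.rfl

/-- The leading coefficient 1 forces the eigenvalue. -/
theorem isJack_iff {β : ℕ} {lam : Fin N → ℕ} (hlam : Antitone lam) {J : Poly N} :
    IsJack β lam J ↔ J - mono lam ∈ Submodule.span ℂ (mono '' lowerSet lam (· = ∑ i, lam i)) ∧
      sutherland N β J = ((jackEigenvalue β lam : ℂ) + sutherlandShift N β) • J := by
  rw [isJack_def]
  refine and_congr_right fun hmem => ⟨?_, fun h => ⟨_, h⟩⟩
  rintro ⟨c, hc⟩
  obtain ⟨hs, hsup, hl⟩ := (mem_span_lowerSet_iff hlam _).mp hmem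
  have hJs := hs.add (isSymmetric_mono lam)
  rw [sub_add_cancel] at hJs
  have hJm := Submodule.add_mem _ hsup
    (mono_mem_restrictSupport (p := (· = ∑ i, lam i)) (dominated_self hlam) rfl)
  rw [sub_add_cancel] at hJm
  have hJc : J.coeff (Finsupp.equivFunOnFinite.symm lam) = 1 := by
    rw [coeff_sub, coeff_mono_self, sub_eq_zero] at hl
    exact hl
  have h1 := coeff_sutherland (lam := Finsupp.equivFunOnFinite.symm lam) β hJs hJm
  rw [hc, coeff_smul, hJc, smul_eq_mul, mul_one, mul_one, Finsupp.coe_equivFunOnFinite_symm] at h1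
  rw [hc, h1]

/-- `T` maps `m_lam` and the finite-dimensional span `U` of lower terms into `U`, and is injective
on `U` because eigenvalues there are smaller. So `T u = T m_lam` has a solution `u` in `U`, and `J =
m_lam - u`. -/
theorem existsUnique_isJack (β : ℕ) {lam : Fin N → ℕ} (hlam : Antitone lam) :
    ∃! J : Poly N, IsJack β lam J := by
  set U := Submodule.span ℂ (mono '' lowerSet lam (· = ∑ i, lam i)) with hU
  set E : ℂ := (jackEigenvalue β lam : ℂ) + sutherlandShift N β with hE
  set T : Module.End ℂ (Poly N) := sutherland N β - E • 1 with hT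
  have hTa (f : Poly N) : T f = sutherland N β f - E • f := rfl
  have hTU : ∀ f ∈ U, T f ∈ U := by
    intro f hf
    obtain ⟨hs, hsup, hl⟩ := (mem_span_lowerSet_iff hlam _).mp hf
    refine (mem_span_lowerSet_iff hlam _).mpr ⟨(isSymmetric_sutherland β hs).sub (hs.smul _),
      Submodule.sub_mem _ (sutherland_mem β hs hsup) (Submodule.smul_mem _ _ hsup), ?_⟩
    rw [hTa, coeff_sub, coeff_smul, hl,
      coeff_sutherland (lam := Finsupp.equivFunOnFinite.symm lam) β hs hsup, hl]
    simp
  have hTm : T (mono lam) ∈ U := by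
    have hs := isSymmetric_mono lam
    have hsup := mono_mem_restrictSupport (p := (· = ∑ i, lam i)) (dominated_self hlam) rfl
    refine (mem_span_lowerSet_iff hlam _).mpr ⟨(isSymmetric_sutherland β hs).sub (hs.smul _),
      Submodule.sub_mem _ (sutherland_mem β hs hsup) (Submodule.smul_mem _ _ hsup), ?_⟩
    rw [hTa, coeff_sub, coeff_smul, coeff_sutherland_mono_self β hlam, coeff_mono_self]
    simp [hE]
  have : FiniteDimensional ℂ U :=
    FiniteDimensional.span_of_finite ℂ ((finite_lowerSet lam _).image _)
  have hinj : Function.Injective (T.restrict hTU) := by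
    rw [← LinearMap.ker_eq_bot, LinearMap.ker_eq_bot']
    rintro ⟨f, hf⟩ h
    have h' : T f = 0 := congrArg Subtype.val h
    rw [hTa, sub_eq_zero] at h'
    exact Subtype.ext (eq_zero_of_mem_lower β hlam hf h')
  obtain ⟨⟨u, hu⟩, hsol⟩ := LinearMap.surjective_of_injective hinj ⟨T (mono lam), hTm⟩
  have hsol' : T u = T (mono lam) := congrArg Subtype.val hsol
  refine ⟨mono lam - u, (isJack_iff hlam).mpr ⟨?_, ?_⟩, ?_⟩
  · rw [sub_sub_cancel_left]
    exact Submodule.neg_mem _ hu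
  · rw [← sub_eq_zero, ← hE, ← hTa, map_sub, hsol', sub_self]
  · intro J hJ
    obtain ⟨h1, h2⟩ := (isJack_iff hlam).mp hJ
    rw [← sub_eq_zero]
    refine eq_zero_of_mem_lower β hlam (f := J - (mono lam - u)) ?_ ?_
    · rw [sub_sub_eq_add_sub, add_comm, add_sub_assoc, add_comm]
      exact Submodule.add_mem _ h1 hu
    · have h3 : T (mono lam - u) = 0 := by rw [map_sub, hsol', sub_self]
      rw [hTa, sub_eq_zero] at h3
      rw [map_sub (sutherland N β) J, h2, h3, ← hE, ← smul_sub]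

theorem IsJack.isSymmetric {β : ℕ} {lam : Fin N → ℕ} {J : Poly N} (hJ : IsJack β lam J) :
    J.IsSymmetric := by
  have h := (isSymmetric_of_mem_span hJ.1).add (isSymmetric_mono lam)
  rwa [sub_add_cancel] at h

theorem IsJack.mem_restrictSupport {β : ℕ} {lam : Fin N → ℕ} (hlam : Antitone lam) {J : Poly N}
    (hJ : IsJack β lam J) : J ∈ restrictSupport ℂ (domSet lam (· = ∑ i, lam i)) := by
  have h := Submodule.add_mem _ ((mem_span_lowerSet_iff hlam _).mp ((isJack_iff hlam).mp hJ).1).2.1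
    (mono_mem_restrictSupport (p := (· = ∑ i, lam i)) (dominated_self hlam) rfl)
  rwa [sub_add_cancel] at h

theorem IsJack.isHomogeneous {β : ℕ} {lam : Fin N → ℕ} (hlam : Antitone lam) {J : Poly N}
    (hJ : IsJack β lam J) : J.IsHomogeneous (∑ i, lam i) := by
  intro α hα
  have h := (hJ.mem_restrictSupport hlam (mem_support_iff.mpr hα)).2
  rw [← h, ← Finsupp.degree_eq_sum]
  exact (congrArg (· α) (Finsupp.degree_eq_weight_one (R := ℕ))).symm

/-! ### Laguerre polynomials -/

theorem expand_mem_span {s : Set (Fin N → ℕ)} {f : Poly N}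
    (hf : f ∈ Submodule.span ℂ (mono '' s)) :
    expand 2 f ∈ Submodule.span ℂ (monoSq '' s) := by
  have h := Submodule.mem_map_of_mem (f := (expand 2 : Poly N →ₐ[ℂ] Poly N).toLinearMap) hf
  rw [Submodule.map_span, Set.image_image] at h
  exact h

theorem laplaceA_iterate {lam : Fin N → ℕ} (β : ℕ) (γ : ℝ) {f : Poly N} (hs : f.IsSymmetric)
    {n : ℕ} (hf : f ∈ restrictSupport ℂ (domSet lam (· ≤ n))) (k : ℕ) :
    ((laplaceA β γ)^[k + 1] f).IsSymmetric ∧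
      (laplaceA β γ)^[k + 1] f ∈ restrictSupport ℂ (domSet lam (· + 1 ≤ n)) := by
  induction k with
  | zero => exact ⟨isSymmetric_laplaceA β γ hs, laplaceA_mem β γ hf⟩
  | succ k ih =>
    rw [Function.iterate_succ_apply']
    exact ⟨isSymmetric_laplaceA β γ ih.1,
      restrictSupport_mono ℂ (domSet_mono fun _ => Nat.le_of_succ_le) (laplaceA_mem β γ ih.2)⟩

theorem dunklLaplace_pow_expand (β : ℕ) (γ : ℝ) (k : ℕ) (f : Poly N) :
    (dunklLaplace N β γ ^ k) (expand 2 f) = expand 2 ((laplaceA β γ)^[k] f) := by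
  induction k with
  | zero => rfl
  | succ k ih =>
    rw [pow_succ', Module.End.mul_apply, ih, dunklLaplace_expand, Function.iterate_succ_apply']

/-- Subtracting `f (z²)` removes the zeroth term of `exp (-Δ / 4)`. The others stay dominated by
`lam` but have smaller degree, so `lam` itself cannot occur. -/
theorem sigmaB_sub_expand_mem (β : ℕ) (γ : ℝ) {lam : Fin N → ℕ} (hlam : Antitone lam) {f : Poly N}
    (hs : f.IsSymmetric) (hf : f ∈ restrictSupport ℂ (domSet lam (· = ∑ i, lam i))) :
    sigmaB β γ f - expand 2 f ∈ Submodule.span ℂ (monoSq '' lowerSet lam fun _ => True) := by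
  obtain ⟨K, hK⟩ := gaussT_eq_sum β γ (expand 2 f)
  have hf' : f ∈ restrictSupport ℂ (domSet lam (· ≤ ∑ i, lam i)) :=
    restrictSupport_mono ℂ (domSet_mono fun _ h => h.le) hf
  rw [sigmaB_eq_gaussT, hK (K + 1) (Nat.le_succ K), Finset.sum_range_succ']
  simp only [pow_zero, Nat.factorial_zero, Nat.cast_one, div_one, one_smul, Module.End.one_apply,
    add_sub_cancel_right, dunklLaplace_pow_expand]
  refine Submodule.sum_mem _ fun k _ => Submodule.smul_mem _ _ (expand_mem_span ?_)
  obtain ⟨h1, h2⟩ := laplaceA_iterate β γ hs hf' k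
  refine (mem_span_lowerSet_iff hlam _).mpr
    ⟨h1, restrictSupport_mono ℂ (domSet_mono fun _ _ => trivial) h2, coeff_of_notMem h2 ?_⟩
  intro h
  exact absurd h.2 (Nat.not_succ_le_self _)

theorem sigmaB_isJack_mem {β : ℕ} (γ : ℝ) {lam : Fin N → ℕ} (hlam : Antitone lam) {J : Poly N}
    (hJ : IsJack β lam J) :
    sigmaB β γ J - monoSq lam ∈ Submodule.span ℂ (monoSq '' lowerSet lam fun _ => True) := by
  have h1 := sigmaB_sub_expand_mem β γ hlam hJ.isSymmetric (hJ.mem_restrictSupport hlam)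
  have h2 := expand_mem_span (Submodule.span_mono (Set.image_mono (f := mono) fun ν
    (hν : ν ∈ lowerSet lam (· = ∑ i, lam i)) =>
    (⟨hν.1, hν.2.1, trivial⟩ : ν ∈ lowerSet lam fun _ => True)) ((isJack_iff hlam).mp hJ).1)
  have h3 := Submodule.add_mem _ h1 h2
  rwa [map_sub, sub_add_sub_cancel] at h3

theorem evenForm_isJack_eq_zero {γ : ℝ} (hγ : -1 / 2 < γ) {β : ℕ} {lam μ : Fin N → ℕ}
    (hlam : Antitone lam) (hμ : Antitone μ) (h : DomLT μ lam) {J K : Poly N}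
    (hJ : IsJack β lam J) (hK : IsJack β μ K) : evenForm β γ J K = 0 := by
  by_cases hw : ∑ i, μ i = ∑ i, lam i
  · refine (isEvenAdjoint_sutherland hγ β).evenForm_eq_zero ((isJack_iff hlam).mp hJ).2
      ((isJack_iff hμ).mp hK).2 fun e => ?_
    have h' : jackEigenvalue β lam = jackEigenvalue β μ := by exact_mod_cast add_right_cancel e
    exact (jackEigenvalue_lt β hμ h hw).ne' h'
  · refine IsEvenAdjoint.evenForm_eq_zero (IsEvenAdjoint.sum Finset.univ fun j _ =>
      isEvenAdjoint_eulerA hγ β j)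
      (sum_eulerA_of_isSymmetric β hJ.isSymmetric (hJ.isHomogeneous hlam))
      (sum_eulerA_of_isSymmetric β hK.isSymmetric (hK.isHomogeneous hμ)) fun e => ?_
    exact hw (by exact_mod_cast e.symm)

theorem scalarB_eq_zero_of_mem_span {γ : ℝ} (hγ : -1 / 2 < γ) {β : ℕ} {s : Set (Poly N)}
    {f g : Poly N} (h : ∀ u ∈ s, scalarB β γ f u = 0) (hg : g ∈ Submodule.span ℂ s) :
    scalarB β γ f g = 0 := by
  simp only [scalarB_eq_zero_iff hγ] at h ⊢
  have hle : Submodule.span ℂ s ≤ LinearMap.ker ((gInt N β γ).comp (LinearMap.mulLeft ℂ f)) :=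
    Submodule.span_le.mpr h
  exact hle hg

/-- `sigmaB` of the Jack polynomial of `μ` is orthogonal to `sigmaB β γ J` and differs from `m_μ
(z²)` by lower terms, which the induction on rank handles. -/
theorem scalarB_sigmaB_monoSq {γ : ℝ} (hγ : -1 / 2 < γ) {β : ℕ} {lam : Fin N → ℕ}
    (hlam : Antitone lam) {J : Poly N} (hJ : IsJack β lam J) (μ : Fin N → ℕ) (hμ : Antitone μ)
    (h : DomLT μ lam) : scalarB β γ (sigmaB β γ J) (monoSq μ) = 0 := by
  induction hn : rankSum μ using Nat.strong_induction_on generalizing μ with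
  | _ n ih =>
    subst hn
    obtain ⟨K, hK, -⟩ := existsUnique_isJack β hμ
    have h1 : scalarB β γ (sigmaB β γ J) (sigmaB β γ K) = 0 :=
      (scalarB_sigmaB_eq_zero_iff hγ β J K).mpr (evenForm_isJack_eq_zero hγ hlam hμ h hJ hK)
    have h2 : scalarB β γ (sigmaB β γ J) (sigmaB β γ K - monoSq μ) = 0 := by
      refine scalarB_eq_zero_of_mem_span hγ ?_ (sigmaB_isJack_mem γ hμ hK)
      rintro _ ⟨ν, ⟨hν, hlt, -⟩, rfl⟩
      exact ih _ hlt.rankSum_lt ν hν (hlt.trans h) rfl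
    rw [scalarB_eq_zero_iff hγ] at h1 h2 ⊢
    rwa [mul_sub, map_sub, h1, zero_sub, neg_eq_zero] at h2

theorem lowerSet_true (lam : Fin N → ℕ) :
    (lowerSet lam fun _ => True) = {μ : Fin N → ℕ | Antitone μ ∧ DomLT μ lam} := by
  ext μ
  exact ⟨fun h => ⟨h.1, h.2.1⟩, fun h => ⟨h.1, h.2, trivial⟩⟩

theorem isLaguerre_sigmaB {γ : ℝ} (hγ : -1 / 2 < γ) {β : ℕ} {lam : Fin N → ℕ}
    (hlam : Antitone lam) {J : Poly N} (hJ : IsJack β lam J) :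
    IsLaguerre β γ lam (sigmaB β γ J) :=
  ⟨lowerSet_true lam ▸ sigmaB_isJack_mem γ hlam hJ, scalarB_sigmaB_monoSq hγ hlam hJ⟩

theorem map_conj_monoSq (μ : Fin N → ℕ) : map (starRingEnd ℂ) (monoSq μ) = monoSq μ := by
  simp only [monoSq, map_expand, mono, map_sum, map_monomial, map_one]

theorem map_conj_mem_span {s : Set (Fin N → ℕ)} {f : Poly N}
    (hf : f ∈ Submodule.span ℂ (monoSq '' s)) :
    map (starRingEnd ℂ) f ∈ Submodule.span ℂ (monoSq '' s) := by
  induction hf using Submodule.span_induction with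
  | mem x hx =>
    obtain ⟨μ, hμ, rfl⟩ := hx
    rw [map_conj_monoSq]
    exact Submodule.subset_span ⟨μ, hμ, rfl⟩
  | zero => rw [map_zero]; exact Submodule.zero_mem _
  | add f g _ _ hf hg => rw [map_add]; exact Submodule.add_mem _ hf hg
  | smul c f _ hf =>
    rw [smul_eq_C_mul, map_mul, map_C, ← smul_eq_C_mul]
    exact Submodule.smul_mem _ _ hf

/-- The difference lies in the conjugation-stable span of the lower `m_μ (z²)` and is orthogonal to
it, hence to its own conjugate. -/
theorem IsLaguerre.unique {γ : ℝ} (hγ : -1 / 2 < γ) {β : ℕ} {lam : Fin N → ℕ} {L L' : Poly N}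
    (h : IsLaguerre β γ lam L) (h' : IsLaguerre β γ lam L') : L = L' := by
  have hd := Submodule.sub_mem _ h.1 h'.1
  rw [sub_sub_sub_cancel_right] at hd
  rw [← sub_eq_zero]
  refine eq_zero_of_scalarB_conj_eq_zero hγ β _
    (scalarB_eq_zero_of_mem_span hγ ?_ (map_conj_mem_span hd))
  rintro _ ⟨μ, ⟨hμ, hlt⟩, rfl⟩
  have h1 := h.2 μ hμ hlt
  have h2 := h'.2 μ hμ hlt
  rw [scalarB_eq_zero_iff hγ] at h1 h2 ⊢
  rw [sub_mul, map_sub, h1, h2, sub_zero]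

end CalogeroLaguerre


end

theorem mainTheorem4 (N β : ℕ) (γ : ℝ) (hγ : -1 / 2 < γ) (lam : Fin N → ℕ) (hlam : Antitone lam) :
    (∀ f g : CalogeroLaguerre.Poly N, Integrable (CalogeroLaguerre.integrandB β γ f g)) ∧
    (∃! J : CalogeroLaguerre.Poly N, CalogeroLaguerre.IsJack β lam J) ∧
    (∃! L : CalogeroLaguerre.Poly N, CalogeroLaguerre.IsLaguerre β γ lam L) ∧
    ∀ J L : CalogeroLaguerre.Poly N, CalogeroLaguerre.IsJack β lam J →
      CalogeroLaguerre.IsLaguerre β γ lam L → L = CalogeroLaguerre.sigmaB β γ J := by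
  have hJ := CalogeroLaguerre.existsUnique_isJack β hlam
  obtain ⟨J, hJ1⟩ := hJ.exists
  -- The Laguerre polynomial is shown to exist by exhibiting `sigmaB β γ J`; uniqueness then gives
  -- the identity.
  refine ⟨CalogeroLaguerre.integrable_integrandB hγ β, hJ,
    ⟨_, CalogeroLaguerre.isLaguerre_sigmaB hγ hlam hJ1, fun L hL =>
      hL.unique hγ (CalogeroLaguerre.isLaguerre_sigmaB hγ hlam hJ1)⟩, fun K L hK hL =>
      hL.unique hγ (CalogeroLaguerre.isLaguerre_sigmaB hγ hlam hK)⟩
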